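/- Let $\mathbb H^2$ be the hyperbolic plane of curvature $-1$ with distance $d$. For $r>0$, a graph $G$ is a hyperbolic uniform disk graph with radius $r$ if each vertex $v$ can be assigned a center $c_v\in\mathbb H^2$ such that distinct vertices $u,v$ are adjacent if and only if the closed disks $O_u,O_v$ of radius $r$ about $c_u,c_v$ intersect. All graphs are finite. A tree decomposition of $G$ is a tree $T$ with bags $X_t\subseteq V(G)$, $t\in V(T)$, such that every vertex lies in some bag, the two ends of every edge lie in a common bag and, for each $v$, the nodes $t$ with $v\in X_t$ induce a connected (nonempty) subgraph of $T$. A layering of $G$ is a sequence $(V_0,V_1,\dots)$ of pairwise disjoint sets with union $V(G)$, empty from some index on, such that each edge joins vertices in the same layer or in two consecutive layers. They witness layered tree-independence number $k$ if $\alpha(G[X_t\cap V_i])\le k$ for all $t,i$; the layered tree-independence number of $G$ is the least $k$ that is witnessed by some tree decomposition and layering of $G$. A polar-coordinate system consists of a pole $o$ and a ray from $o$, the polar axis; a point $p$ has coordinates $b(p)=d(p,o)$ and $\theta(p)\in[0,2\pi)$, the angle at $o$ from the polar axis to the ray from $o$ through $p$. **Theorem.** (1) There is an algorithm which, given $r>0$,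 $n\ge 1$ and the polar coordinates, in some (arbitrary) polar-coordinate system, of the disk centers of a realization of a hyperbolic uniform disk graph $G$ with radius $r$ on $n$ vertices, computes in $\mathcal O(n\log n)$ time (with the bound on the time depending only on $n$, not on $r$ or the realization) a path decomposition of $G$ with $m\le 2n$ nodes and a layering of $G$ that witness layered tree-independence number $6\lceil r/\tanh r\rceil$. More precisely, there is a polar-coordinate system whose polar axis meets no disk such that, if $z_1<\dots<z_m$ are the elements of $\{\inf_{x\in O_v}\theta(x)\}_{v}\cup\{\sup_{x\in O_v}\theta(x)\}_{v}$, the bag of the $k$-th node of the path is the set of all $v$ for which $O_v$ meets the ray with polar angle $z_k$, and the $i$-th layer ($i\ge 1$) is the set of all $v$ with $(2i-2)r<b(c_v)\le 2ir$. Here the algorithm is a single program for a real RAM which performs, in one step each, the four arithmetic operations and comparison of real numbers, rounding up to an integer, the elementary functions $\exp,\log,\sqrt{\ },\sin,\cos,\arccos$, the computation of $\inf_{x\in O}\theta(x)$ and $\sup_{x\in O}\theta(x)$ for a disk $O$ given by its radius and the polar coordinates of its center, and addition, subtraction and comparison of natural numbers and (indirect) memory access. The decomposition is output by its number $m$ of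 nodes and, for each vertex, the first and the last node of the path whose bag contains it; the layering is output by the index of the layer of each vertex. (2) In particular, every hyperbolic uniform disk graph with radius $r>0$ has layered tree-independence number at most $6\lceil r/\tanh r\rceil$. -/

import Mathlib

open Asymptotics

/-! ### Tree decompositions, layerings, layered tree-independence number -/

/-- `(T, bag)` is a tree decomposition of `G`. -/
structure IsTreeDecomposition {V ι : Type*} (G : SimpleGraph V) (T : SimpleGraph ι)
    (bag : ι → Set V) : Prop where
  isTree : T.IsTree
  vertex_mem : ∀ v : V, ∃ t, v ∈ bag t
  edge_mem : ∀ u v : V, G.Adj u v → ∃ t, u ∈ bag t ∧ v ∈ bag t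
  connected : ∀ v : V, (T.induce {t | v ∈ bag t}).Connected

/-- `(L 0, L 1, …)` is a layering of `G`: pairwise disjoint vertex sets with union `V(G)`, empty
from some index on, such that every edge joins vertices in the same or in consecutive layers. -/
structure IsLayering {V : Type*} (G : SimpleGraph V) (L : ℕ → Set V) : Prop where
  disjoint : ∀ i j : ℕ, i ≠ j → Disjoint (L i) (L j)
  iUnion_eq : ⋃ i, L i = Set.univ
  eventually_empty : ∃ N : ℕ, ∀ i, N ≤ i → L i = ∅
  adj : ∀ u v : V, G.Adj u v → ∀ i j : ℕ, u ∈ L i → v ∈ L j → i ≤ j + 1 ∧ j ≤ i + 1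

/-- Bags and layers witness layered tree-independence number `k`. -/
def WitnessLayered {V ι : Type*} (G : SimpleGraph V) (bag : ι → Set V) (L : ℕ → Set V)
    (k : ℕ) : Prop :=
  ∀ (t : ι) (i : ℕ), (G.induce (bag t ∩ L i)).indepNum ≤ k

/-- The layered independence number of a tree decomposition with the given bags: the least `k` that
is witnessed by some layering. -/
noncomputable def layeredIndepNum {V ι : Type*} (G : SimpleGraph V) (bag : ι → Set V) : ℕ∞ :=
  ⨅ (L : ℕ → Set V) (k : ℕ) (_ : IsLayering G L ∧ WitnessLayered G bag L k), (k : ℕ∞)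

/-- The layered tree-independence number: the least layered independence number of a tree
decomposition of `G` (over finite trees, with nodes numbered). -/
noncomputable def layeredTreeIndepNum {V : Type*} (G : SimpleGraph V) : ℕ∞ :=
  ⨅ (m : ℕ) (T : SimpleGraph (Fin m)) (bag : Fin m → Set V) (_ : IsTreeDecomposition G T bag),
    layeredIndepNum G bag

/-! ### Hyperbolic uniform disk graphs

The hyperbolic plane of curvature `-1` is the upper half-plane with its metric. -/

/-- `G` is the intersection graph of the closed hyperbolic disks of radius `r` with centers `c`. -/
def IsDiskRealization {V : Type*} (G : SimpleGraph V) (r : ℝ) (c : V → UpperHalfPlane) : Prop :=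
  ∀ u v : V, G.Adj u v ↔
    u ≠ v ∧ (Metric.closedBall (c u) r ∩ Metric.closedBall (c v) r).Nonempty

/-- `G` is a hyperbolic uniform disk graph with radius `r`. -/
def IsHyperbolicUniformDiskGraph {V : Type*} (G : SimpleGraph V) (r : ℝ) : Prop :=
  ∃ c : V → UpperHalfPlane, IsDiskRealization G r c

/-- A polar-coordinate system of the hyperbolic plane: the pole and the direction at the pole of the
polar axis, as a rotation (counterclockwise) of the upward vertical direction. -/
structure PolarSystem where
  pole : UpperHalfPlane
  dir : Circle

namespace PolarSystem

/-- The radial coordinate: the hyperbolic distance to the pole. -/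
noncomputable def radius (S : PolarSystem) (p : UpperHalfPlane) : ℝ := dist p S.pole

/-- The polar angle in `[0, 2π)`. The map `p ↦ (p - o) / (p - conj o)` is the conformal isometry
onto the Poincaré disk that takes the pole `o` to the center `0` and the upward direction at `o` to
the positive real direction; rays from `o` become radii, so the argument is the angle at `o`.
The pole itself gets the angle `0`. -/
noncomputable def angle (S : PolarSystem) (p : UpperHalfPlane) : ℝ :=
  toIcoMod Real.two_pi_pos 0
    (Complex.arg
      (((p : ℂ) - (S.pole : ℂ)) / ((p : ℂ) - (starRingEnd ℂ) (S.pole : ℂ)) / (S.dir : ℂ)))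

/-- The ray from the pole with polar angle `z` (the pole belongs to the ray `z = 0`). -/
def ray (S : PolarSystem) (z : ℝ) : Set UpperHalfPlane := {p | S.angle p = z}

/-- `(b, θ)` are polar coordinates of `p`; at the pole `θ` is arbitrary. -/
def IsCoord (S : PolarSystem) (p : UpperHalfPlane) (b θ : ℝ) : Prop :=
  b = S.radius p ∧ (p ≠ S.pole → θ = S.angle p)

/-- The infimum of the polar angles of the points of a disk. -/
noncomputable def angleInf (S : PolarSystem) (c : UpperHalfPlane) (r : ℝ) : ℝ :=
  sInf (S.angle '' Metric.closedBall c r)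

/-- The supremum of the polar angles of the points of a disk. -/
noncomputable def angleSup (S : PolarSystem) (c : UpperHalfPlane) (r : ℝ) : ℝ :=
  sSup (S.angle '' Metric.closedBall c r)

/-- A polar-coordinate system for reference: pole `i`, polar axis upwards. -/
noncomputable def standard : PolarSystem := ⟨UpperHalfPlane.I, 1⟩

end PolarSystem

/-- The angular sweep: no disk meets the polar axis of `S`, the values `z 0 < z 1 < …` enumerate the
extreme polar angles of the disks, and the bag of the `k`-th node of the path consists of the
disks that meet the ray with polar angle `z k`. -/
def IsAngularSweep {n m : ℕ} (S : PolarSystem) (r : ℝ) (c : Fin n → UpperHalfPlane)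
    (bag : Fin m → Set (Fin n)) : Prop :=
  (∀ v, Disjoint (Metric.closedBall (c v) r) (S.ray 0)) ∧
  ∃ z : Fin m → ℝ, StrictMono z ∧
    Set.range z =
      Set.range (fun v => S.angleInf (c v) r) ∪ Set.range (fun v => S.angleSup (c v) r) ∧
    ∀ k, bag k = {v | (Metric.closedBall (c v) r ∩ S.ray (z k)).Nonempty}

/-- The `i`-th layer consists of the disks with center in the annulus
`(2 i - 2) r < b ≤ 2 i r` of width `2 r` about the pole. -/
def IsAnnularLayering {n : ℕ} (S : PolarSystem) (r : ℝ) (c : Fin n → UpperHalfPlane)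
    (L : ℕ → Set (Fin n)) : Prop :=
  ∀ i : ℕ, L i = {v | (2 * (i : ℝ) - 2) * r < S.radius (c v) ∧ S.radius (c v) ≤ 2 * (i : ℝ) * r}

/-! ### A real RAM with step count

Programs are finite pieces of code over a memory with arrays of natural numbers and arrays of real
numbers. The array is named in the code, the position in it may be computed (indirect addressing).
Each operation, memory access, test and assignment costs one step. -/

namespace RealRAM

/-- Memory: `nat a i` and `real a i` are the entries at position `i` of the arrays numbered `a`. -/
structure State where
  nat : ℕ → ℕ → ℕ
  real : ℕ → ℕ → ℝ

/-- Expressions for natural numbers (no multiplication). -/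
inductive NExp where
  | lit (k : ℕ)
  | get (a : ℕ) (i : NExp)
  | plus (x y : NExp)
  | monus (x y : NExp)

/-- Elementary functions that the machine evaluates in one step. -/
inductive Fn where
  | exp | log | sqrt | sin | cos | arccos

/-- Expressions for real numbers. `angInf x y z` and `angSup x y z` are the infimum and the supremum
of the polar angles of the points in the disk with radius `z` whose center has polar coordinates
`(x, y)`. -/
inductive RExp where
  | lit (q : ℚ)
  | get (a : ℕ) (i : NExp)
  | plus (x y : RExp)
  | minus (x y : RExp)
  | times (x y : RExp)
  | divide (x y : RExp)
  | fn (f : Fn) (x : RExp)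
  | angInf (x y z : RExp)
  | angSup (x y z : RExp)

/-- Tests. -/
inductive Test where
  | ltN (x y : NExp)
  | ltR (x y : RExp)
  | neg (p : Test)
  | both (p q : Test)

/-- Programs: `setN a i x` and `setR a i x` write the value of `x` at position `i` of array `a`,
and `setCeil a i x` writes the real number `x`, rounded up, as a natural number. -/
inductive Prog where
  | setN (a : ℕ) (i x : NExp)
  | setR (a : ℕ) (i : NExp) (x : RExp)
  | setCeil (a : ℕ) (i : NExp) (x : RExp)
  | seq (p q : Prog)
  | cond (b : Test) (p q : Prog)
  | loop (b : Test) (p : Prog)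

def NExp.eval (s : State) : NExp → ℕ
  | .lit k => k
  | .get a i => s.nat a (i.eval s)
  | .plus x y => x.eval s + y.eval s
  | .monus x y => x.eval s - y.eval s

def NExp.cost : NExp → ℕ
  | .lit _ => 1
  | .get _ i => i.cost + 1
  | .plus x y => x.cost + y.cost + 1
  | .monus x y => x.cost + y.cost + 1

noncomputable def Fn.eval : Fn → ℝ → ℝ
  | .exp => Real.exp
  | .log => Real.log
  | .sqrt => Real.sqrt
  | .sin => Real.sin
  | .cos => Real.cos
  | .arccos => Real.arccos

/-- Polar angles in the disk of radius `ρ` whose center has polar coordinates `(b, θ)`; the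
set does not depend on the polar-coordinate system in which it is computed. -/
def discAngles (b θ ρ : ℝ) : Set ℝ :=
  {x | ∃ c p : UpperHalfPlane, PolarSystem.standard.IsCoord c b θ ∧ dist p c ≤ ρ ∧
    x = PolarSystem.standard.angle p}

noncomputable def RExp.eval (s : State) : RExp → ℝ
  | .lit q => (q : ℝ)
  | .get a i => s.real a (i.eval s)
  | .plus x y => x.eval s + y.eval s
  | .minus x y => x.eval s - y.eval s
  | .times x y => x.eval s * y.eval s
  | .divide x y => x.eval s / y.eval s
  | .fn f x => f.eval (x.eval s)
  | .angInf x y z => sInf (discAngles (x.eval s) (y.eval s) (z.eval s))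
  | .angSup x y z => sSup (discAngles (x.eval s) (y.eval s) (z.eval s))

def RExp.cost : RExp → ℕ
  | .lit _ => 1
  | .get _ i => i.cost + 1
  | .plus x y => x.cost + y.cost + 1
  | .minus x y => x.cost + y.cost + 1
  | .times x y => x.cost + y.cost + 1
  | .divide x y => x.cost + y.cost + 1
  | .fn _ x => x.cost + 1
  | .angInf x y z => x.cost + y.cost + z.cost + 1
  | .angSup x y z => x.cost + y.cost + z.cost + 1

def Test.holds (s : State) : Test → Prop
  | .ltN x y => x.eval s < y.eval s
  | .ltR x y => x.eval s < y.eval s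
  | .neg p => ¬ p.holds s
  | .both p q => p.holds s ∧ q.holds s

def Test.cost : Test → ℕ
  | .ltN x y => x.cost + y.cost + 1
  | .ltR x y => x.cost + y.cost + 1
  | .neg p => p.cost + 1
  | .both p q => p.cost + q.cost + 1

def State.writeNat (s : State) (a i x : ℕ) : State :=
  { s with nat := Function.update s.nat a (Function.update (s.nat a) i x) }

noncomputable def State.writeReal (s : State) (a i : ℕ) (x : ℝ) : State :=
  { s with real := Function.update s.real a (Function.update (s.real a) i x) }

/-- `Exec p s t s'`: started in memory `s`, the program `p` halts after `t` steps in memory `s'`. -/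
inductive Exec : Prog → State → ℕ → State → Prop where
  | setN (a : ℕ) (i x : NExp) (s : State) :
      Exec (.setN a i x) s (i.cost + x.cost + 1) (s.writeNat a (i.eval s) (x.eval s))
  | setR (a : ℕ) (i : NExp) (x : RExp) (s : State) :
      Exec (.setR a i x) s (i.cost + x.cost + 1) (s.writeReal a (i.eval s) (x.eval s))
  | setCeil (a : ℕ) (i : NExp) (x : RExp) (s : State) :
      Exec (.setCeil a i x) s (i.cost + x.cost + 1) (s.writeNat a (i.eval s) ⌈x.eval s⌉₊)
  | seq {p q : Prog} {s s' s'' : State} {t t' : ℕ} (h : Exec p s t s') (h' : Exec q s' t' s'') :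
      Exec (.seq p q) s (t + t') s''
  | cond_true {b : Test} {p q : Prog} {s s' : State} {t : ℕ} (hb : b.holds s)
      (h : Exec p s t s') : Exec (.cond b p q) s (b.cost + t) s'
  | cond_false {b : Test} {p q : Prog} {s s' : State} {t : ℕ} (hb : ¬ b.holds s)
      (h : Exec q s t s') : Exec (.cond b p q) s (b.cost + t) s'
  | loop_done {b : Test} {p : Prog} {s : State} (hb : ¬ b.holds s) :
      Exec (.loop b p) s b.cost s
  | loop_step {b : Test} {p : Prog} {s s' s'' : State} {t t' : ℕ} (hb : b.holds s)
      (h : Exec p s t s') (h' : Exec (.loop b p) s' t' s'') :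
      Exec (.loop b p) s (b.cost + t + t') s''

/-- The input: the number `n` of disks at position `0` of the natural array `0`, the radius `r` at
position `0` of the real array `0`, and the polar coordinates of the `v`-th center at position `v`
of the real arrays `1` and `2`. All other entries are `0`. -/
noncomputable def input (n : ℕ) (r : ℝ) (b θ : Fin n → ℝ) : State where
  nat a i := if a = 0 ∧ i = 0 then n else 0
  real a i :=
    if a = 0 ∧ i = 0 then r
    else if h : i < n then
      if a = 1 then b ⟨i, h⟩ else if a = 2 then θ ⟨i, h⟩ else 0
    else 0

/-- The output encodes a path decomposition and a layering in linear space: position `0` of the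
natural array `0` holds the number of nodes of the path, and position `v` of the natural arrays
`1`, `2`, `3` holds the first node whose bag contains `v`, the last one, and the layer of `v`. -/
def State.numNodes (s : State) : ℕ := s.nat 0 0

/-- The bags of the path decomposition in the output. -/
def State.bag (s : State) (n : ℕ) (k : Fin s.numNodes) : Set (Fin n) :=
  {v | s.nat 1 v ≤ k ∧ (k : ℕ) ≤ s.nat 2 v}

/-- The layers in the output. -/
def State.layer (s : State) (n : ℕ) (i : ℕ) : Set (Fin n) := {v | s.nat 3 v = i}

end RealRAM

/-!
Geometry. In hyperboloid coordinates `(cosh b, sinh b cos θ, sinh b sin θ)` (the temporal part and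
`PolarSystem.spatial`) the distance of two points is given by the Lorentz product
(`PolarSystem.cosh_dist`), and moving the pole along the polar axis is a Lorentz boost
(`PolarSystem.exists_boost`). If the pole is moved farther than all disks reach and the new axis
points away from the old pole, then the new axis meets no disk (`disjoint_ray_of_boost`). Each disk
is then seen from the pole in an interval of polar angles (`PolarSystem.image_angle_eq_Icc`), which
depends only on the radius and on the polar coordinates of the center
(`PolarSystem.image_angle_closedBall`). So the bags of the angular sweep come from intervals on a
line, and form a path decomposition, while intersecting disks have centers at distance at most `2 r`
and hence lie in the same or in consecutive annuli of width `2 r`.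

Independence number. The centers of disks that meet a ray are within distance `r` of the line that
carries it. For centers in an annulus of width `2 r`, the feet of the perpendiculars to the line lie
in an interval of length `3 r`. Two centers on the same side whose feet have distance at most
`tanh r` have distance at most `2 r` (`fermi_cosh_le`), so that their disks intersect. Pairwise
disjoint disks are therefore distinguished by the side of the ray and by the cell of the foot in a
subdivision of the interval into `⌈3 r / tanh r⌉ ≤ 3 ⌈r / tanh r⌉` cells (`card_le_of_meet_ray`).

Algorithm. `RealRAM.sweepProg` computes the polar coordinates with respect to the moved pole, the two
extreme polar angles of each disk and its layer in linear time, sorts the `2 n` extreme angles by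
bottom-up merge sort, and replaces them by their ranks. Correctness and running time are proved
together, in a program logic (`RealRAM.Runs`) whose rules for sequences and loops add up step bounds;
a syntactic frame property (`RealRAM.Exec.frame`) supplies what a program leaves unchanged. That the
sorted list contains every index is preserved by merging because the set of entries of each pair of
blocks is; multiplicities need not be tracked.
-/

/-! ### Arguments in `[0, 2π)` -/

/-- The argument of a complex number in `[0, 2π)`; it is `0` at `0`. -/
noncomputable def argIco (z : ℂ) : ℝ := toIcoMod Real.two_pi_pos 0 z.arg

theorem argIco_mem (z : ℂ) : argIco z ∈ Set.Ico 0 (2 * Real.pi) :=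
  toIcoMod_mem_Ico' _ _

theorem norm_mul_exp_argIco (z : ℂ) : (‖z‖ : ℂ) * Complex.exp (argIco z * Complex.I) = z := by
  have h : argIco z = z.arg - toIcoDiv Real.two_pi_pos 0 z.arg • (2 * Real.pi) :=
    (self_sub_toIcoDiv_zsmul _ _ _).symm
  have h2 : ((argIco z : ℝ) : ℂ) * Complex.I
      = z.arg * Complex.I - (toIcoDiv Real.two_pi_pos 0 z.arg : ℤ) * (2 * Real.pi * Complex.I) := by
    rw [h]; push_cast; simp; ring
  rw [h2, Complex.exp_periodic.sub_int_mul_eq, Complex.norm_mul_exp_arg_mul_I]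

theorem argIco_mul_exp {r θ : ℝ} (hr : 0 < r) (hθ : θ ∈ Set.Ico 0 (2 * Real.pi)) :
    argIco (r * Complex.exp (θ * Complex.I)) = θ := by
  unfold argIco
  rw [Complex.arg_real_mul _ hr, Complex.arg_exp_mul_I, toIcoMod_toIocMod, toIcoMod_eq_self]
  simpa using hθ

theorem argIco_smul {r : ℝ} (hr : 0 < r) (z : ℂ) : argIco (r * z) = argIco z := by
  unfold argIco
  rw [Complex.arg_real_mul _ hr]

theorem argIco_eq_of_neg_mem_slitPlane {z : ℂ} (hz : -z ∈ Complex.slitPlane) :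
    argIco z = (-z).arg + Real.pi := by
  have h1 : z = ((‖z‖ : ℝ) : ℂ) * Complex.exp (((-z).arg + Real.pi : ℝ) * Complex.I) := by
    have := Complex.norm_mul_exp_arg_mul_I (-z)
    push_cast
    rw [add_mul, Complex.exp_add, Complex.exp_pi_mul_I]
    rw [norm_neg] at this
    linear_combination this
  have h0 : z ≠ 0 := by
    rintro rfl
    simp at hz
  conv_lhs => rw [h1]
  apply argIco_mul_exp (norm_pos_iff.mpr h0)
  have h2 := Complex.neg_pi_lt_arg (-z)
  have h3 := Complex.arg_le_pi (-z)
  have h4 : (-z).arg ≠ Real.pi := Complex.slitPlane_arg_ne_pi hz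
  have h5 := lt_of_le_of_ne h3 h4
  constructor <;> linarith

theorem continuousOn_argIco : ContinuousOn argIco {z | -z ∈ Complex.slitPlane} := by
  have : ContinuousOn (fun z : ℂ => (-z).arg + Real.pi) {z | -z ∈ Complex.slitPlane} := by
    intro z hz
    have : ContinuousAt (fun z : ℂ => (-z).arg) z :=
      ContinuousAt.comp (f := fun z : ℂ => -z) (Complex.continuousAt_arg hz)
        continuous_neg.continuousAt
    exact (this.add continuousAt_const).continuousWithinAt
  exact this.congr fun z hz => argIco_eq_of_neg_mem_slitPlane hz

theorem argIco_eq_zero_iff {z : ℂ} : argIco z = 0 ↔ 0 ≤ z.re ∧ z.im = 0 := by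
  constructor
  · intro h
    have := norm_mul_exp_argIco z
    rw [h] at this
    simp at this
    rw [← this]
    simp
  · rintro ⟨h1, h2⟩
    have : z = (z.re : ℂ) := by apply Complex.ext <;> simp [h2]
    unfold argIco
    rw [this, Complex.arg_ofReal_of_nonneg h1]
    rw [toIcoMod_eq_self]
    simp [Real.pi_pos]

/-! ### Hyperboloid coordinates -/

namespace PolarSystem

/-- The spatial part of the coordinates of `p` in the hyperboloid model, with the pole at
`(1, 0)` and the polar axis in the positive real direction; the temporal part is
`cosh (S.radius p)`. In polar coordinates `(b, θ)` it is `sinh b * exp (i θ)`. -/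
noncomputable def spatial (S : PolarSystem) (p : UpperHalfPlane) : ℂ :=
  ((p : ℂ) - S.pole) * ((starRingEnd ℂ) p - S.pole) / (2 * p.im * S.pole.im) / S.dir

theorem dir_mul_conj (S : PolarSystem) : (S.dir : ℂ) * (starRingEnd ℂ) (S.dir : ℂ) = 1 := by
  rw [Complex.mul_conj, Complex.normSq_eq_norm_sq, Circle.norm_coe]; simp

theorem spatial_mul_dir (S : PolarSystem) (p : UpperHalfPlane) :
    S.spatial p * S.dir =
      ⟨((p.re - S.pole.re) ^ 2 + p.im ^ 2 - S.pole.im ^ 2) / (2 * p.im * S.pole.im),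
        -(p.re - S.pole.re) / p.im⟩ := by
  have h1 := p.im_ne_zero
  have h2 := S.pole.im_ne_zero
  have h : ((2 : ℂ) * p.im * S.pole.im) = ((2 * p.im * S.pole.im : ℝ) : ℂ) := by push_cast; rfl
  rw [spatial, div_mul_cancel₀ _ (Circle.coe_ne_zero _), h]
  apply Complex.ext
  · rw [Complex.div_ofReal_re]
    simp
    congr 1; ring
  · rw [Complex.div_ofReal_im]
    simp
    field_simp
    ring

theorem cosh_radius (S : PolarSystem) (p : UpperHalfPlane) :
    Real.cosh (S.radius p) =
      ((p.re - S.pole.re) ^ 2 + p.im ^ 2 + S.pole.im ^ 2) / (2 * p.im * S.pole.im) := by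
  rw [radius, UpperHalfPlane.cosh_dist']

theorem re_spatial_mul_conj (S : PolarSystem) (p q : UpperHalfPlane) :
    (S.spatial p * (starRingEnd ℂ) (S.spatial q)).re =
      ((p.re - S.pole.re) ^ 2 + p.im ^ 2 - S.pole.im ^ 2) / (2 * p.im * S.pole.im) *
      (((q.re - S.pole.re) ^ 2 + q.im ^ 2 - S.pole.im ^ 2) / (2 * q.im * S.pole.im)) +
      (p.re - S.pole.re) / p.im * ((q.re - S.pole.re) / q.im) := by
  have : S.spatial p * (starRingEnd ℂ) (S.spatial q) =
      (S.spatial p * S.dir) * (starRingEnd ℂ) (S.spatial q * S.dir) := by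
    rw [map_mul]
    linear_combination -(S.spatial p * (starRingEnd ℂ) (S.spatial q)) * S.dir_mul_conj
  rw [this, spatial_mul_dir, spatial_mul_dir]
  simp
  ring

theorem cosh_dist (S : PolarSystem) (p q : UpperHalfPlane) :
    Real.cosh (dist p q) = Real.cosh (S.radius p) * Real.cosh (S.radius q) -
      ((S.spatial p).re * (S.spatial q).re + (S.spatial p).im * (S.spatial q).im) := by
  have h : (S.spatial p).re * (S.spatial q).re + (S.spatial p).im * (S.spatial q).im =
      (S.spatial p * (starRingEnd ℂ) (S.spatial q)).re := by simp
  have h1 := p.im_ne_zero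
  have h2 := S.pole.im_ne_zero
  have h3 := q.im_ne_zero
  rw [h, re_spatial_mul_conj, cosh_radius, cosh_radius, UpperHalfPlane.cosh_dist']
  field_simp
  ring

theorem cosh_radius_sq (S : PolarSystem) (p : UpperHalfPlane) :
    Real.cosh (S.radius p) ^ 2 = 1 + (S.spatial p).re ^ 2 + (S.spatial p).im ^ 2 := by
  have := S.cosh_dist p p
  rw [dist_self, Real.cosh_zero] at this
  linear_combination -this

theorem radius_nonneg (S : PolarSystem) (p : UpperHalfPlane) : 0 ≤ S.radius p := dist_nonneg

theorem norm_spatial (S : PolarSystem) (p : UpperHalfPlane) :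
    ‖S.spatial p‖ = Real.sinh (S.radius p) := by
  have h1 := S.cosh_radius_sq p
  have h2 := Real.cosh_sq (S.radius p)
  rw [← sq_eq_sq₀ (norm_nonneg _) (Real.sinh_nonneg_iff.mpr (S.radius_nonneg p)),
    ← Complex.normSq_eq_norm_sq, Complex.normSq_apply]
  linarith

theorem angle_eq_argIco (S : PolarSystem) (p : UpperHalfPlane) :
    S.angle p = argIco (S.spatial p) := by
  have hne : ((p : ℂ) - (starRingEnd ℂ) (S.pole : ℂ)) ≠ 0 := by
    intro h
    have := congrArg Complex.im h
    simp at this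
    linarith [p.im_pos, S.pole.im_pos]
  have hd : (S.dir : ℂ) ≠ 0 := Circle.coe_ne_zero _
  have h1 := p.im_pos
  have h2 := S.pole.im_pos
  have hc : ((starRingEnd ℂ) (p : ℂ) - S.pole) =
      (starRingEnd ℂ) ((p : ℂ) - (starRingEnd ℂ) (S.pole : ℂ)) := by simp
  have key : S.spatial p = ((‖(p : ℂ) - (starRingEnd ℂ) (S.pole : ℂ)‖ ^ 2 /
      (2 * p.im * S.pole.im) : ℝ) : ℂ) *
      (((p : ℂ) - (S.pole : ℂ)) / ((p : ℂ) - (starRingEnd ℂ) (S.pole : ℂ)) / (S.dir : ℂ)) := by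
    have h3 : (p.im : ℂ) ≠ 0 := by exact_mod_cast h1.ne'
    have h4 : (S.pole.im : ℂ) ≠ 0 := by exact_mod_cast h2.ne'
    push_cast
    rw [← Complex.mul_conj', spatial, hc]
    field_simp
  rw [key, argIco_smul]
  · rfl
  · have : 0 < ‖(p : ℂ) - (starRingEnd ℂ) (S.pole : ℂ)‖ := norm_pos_iff.mpr hne
    positivity

theorem spatial_eq_sinh_mul_exp (S : PolarSystem) (p : UpperHalfPlane) :
    S.spatial p = (Real.sinh (S.radius p) : ℂ) * Complex.exp (S.angle p * Complex.I) := by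
  rw [angle_eq_argIco, ← norm_spatial, norm_mul_exp_argIco]

theorem IsCoord.spatial_eq {S : PolarSystem} {p : UpperHalfPlane} {b θ : ℝ}
    (h : S.IsCoord p b θ) : S.spatial p = Real.sinh b * Complex.exp (θ * Complex.I) := by
  rw [spatial_eq_sinh_mul_exp, h.1]
  by_cases hp : p = S.pole
  · simp [radius, hp]
  · rw [h.2 hp]

theorem IsCoord.re_spatial {S : PolarSystem} {p : UpperHalfPlane} {b θ : ℝ}
    (h : S.IsCoord p b θ) : (S.spatial p).re = Real.sinh b * Real.cos θ := by
  rw [h.spatial_eq, Complex.re_ofReal_mul, Complex.exp_ofReal_mul_I_re]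

theorem IsCoord.im_spatial {S : PolarSystem} {p : UpperHalfPlane} {b θ : ℝ}
    (h : S.IsCoord p b θ) : (S.spatial p).im = Real.sinh b * Real.sin θ := by
  rw [h.spatial_eq, Complex.im_ofReal_mul, Complex.exp_ofReal_mul_I_im]

theorem isCoord_radius_angle (S : PolarSystem) (p : UpperHalfPlane) :
    S.IsCoord p (S.radius p) (S.angle p) := ⟨rfl, fun _ => rfl⟩

/-- Every point of the hyperboloid comes from the upper half-plane: if `X` and `a + b i` are the
temporal and the unrotated spatial part, the imaginary part is that of the pole divided by `X - a`. -/
theorem spatial_surjective (S : PolarSystem) (z : ℂ) : ∃ p, S.spatial p = z := by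
  obtain ⟨a, b, hab⟩ : ∃ a b : ℝ, z * S.dir = ⟨a, b⟩ := ⟨_, _, rfl⟩
  have hX : 0 < Real.sqrt (1 + a ^ 2 + b ^ 2) - a := by
    have : |a| < Real.sqrt (1 + a ^ 2 + b ^ 2) := by
      rw [← Real.sqrt_sq_eq_abs]
      apply Real.sqrt_lt_sqrt (sq_nonneg _)
      nlinarith [sq_nonneg b]
    linarith [le_abs_self a]
  have hsq : Real.sqrt (1 + a ^ 2 + b ^ 2) ^ 2 = 1 + a ^ 2 + b ^ 2 := Real.sq_sqrt (by positivity)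
  set X := Real.sqrt (1 + a ^ 2 + b ^ 2)
  have h2 := S.pole.im_pos
  have hy : 0 < S.pole.im / (X - a) := div_pos h2 hX
  refine ⟨⟨⟨S.pole.re - b * (S.pole.im / (X - a)), S.pole.im / (X - a)⟩, hy⟩, ?_⟩
  apply mul_right_cancel₀ (Circle.coe_ne_zero S.dir)
  rw [spatial_mul_dir, hab]
  have hX' := hX.ne'
  have h2' := h2.ne'
  congr 1
  · simp
    field_simp
    linear_combination -hsq
  · simp
    field_simp

theorem radius_eq_of_spatial_eq {S S' : PolarSystem} {p p' : UpperHalfPlane}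
    (h : S.spatial p = S'.spatial p') : S.radius p = S'.radius p' := by
  have := congrArg (‖·‖) h
  simp only [norm_spatial] at this
  exact Real.sinh_injective this

/-- Passing to the points with the same hyperboloid coordinates in another polar-coordinate system
preserves distances. -/
theorem dist_eq_of_spatial_eq {S S' : PolarSystem} {p p' q q' : UpperHalfPlane}
    (hp : S.spatial p = S'.spatial p') (hq : S.spatial q = S'.spatial q') :
    dist p q = dist p' q' := by
  have h1 := S.cosh_dist p q
  rw [hp, hq, radius_eq_of_spatial_eq hp, radius_eq_of_spatial_eq hq, ← S'.cosh_dist] at h1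
  exact Real.cosh_strictMonoOn.injOn dist_nonneg dist_nonneg h1

theorem angle_eq_of_spatial_eq {S S' : PolarSystem} {p p' : UpperHalfPlane}
    (h : S.spatial p = S'.spatial p') : S.angle p = S'.angle p' := by
  rw [angle_eq_argIco, angle_eq_argIco, h]

/-- The polar angles of the points of a disk depend only on its radius and on the polar
coordinates of its center: two polar-coordinate systems differ by an isometry. -/
theorem image_angle_closedBall {S : PolarSystem} {c : UpperHalfPlane} {b θ : ℝ}
    (h : S.IsCoord c b θ) (ρ : ℝ) :
    S.angle '' Metric.closedBall c ρ = RealRAM.discAngles b θ ρ := by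
  ext x
  constructor
  · rintro ⟨p, hp, rfl⟩
    obtain ⟨c', hc'⟩ := standard.spatial_surjective (S.spatial c)
    obtain ⟨p', hp'⟩ := standard.spatial_surjective (S.spatial p)
    refine ⟨c', p', ⟨?_, ?_⟩, ?_, (angle_eq_of_spatial_eq hp').symm⟩
    · rw [h.1, radius_eq_of_spatial_eq hc']
    · intro hne
      rw [angle_eq_of_spatial_eq hc']
      apply h.2
      intro hc
      apply hne
      rw [← dist_eq_zero]
      change standard.radius c' = 0
      rw [radius_eq_of_spatial_eq hc']
      exact dist_eq_zero.mpr hc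
    · rw [dist_eq_of_spatial_eq hp' hc']
      exact hp
  · rintro ⟨c', p', hc', hd, rfl⟩
    obtain ⟨p, hp⟩ := S.spatial_surjective (standard.spatial p')
    refine ⟨p, ?_, angle_eq_of_spatial_eq hp⟩
    rw [Metric.mem_closedBall, dist_eq_of_spatial_eq hp (h.spatial_eq.trans hc'.spatial_eq.symm)]
    exact hd

/-! ### Moving the pole along the polar axis -/

/-- The map `p ↦ (p - o) / (p - conj o)` to the Poincaré disk in terms of the hyperboloid
coordinates. -/
theorem spatial_mul_sub_conj_pole (S : PolarSystem) (p : UpperHalfPlane) :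
    (1 + Real.cosh (S.radius p)) * ((p : ℂ) - S.pole) =
      S.spatial p * S.dir * ((p : ℂ) - (starRingEnd ℂ) (S.pole : ℂ)) := by
  rw [spatial_mul_dir, ← Complex.ofReal_one, ← Complex.ofReal_add, cosh_radius]
  have h1 := p.im_ne_zero
  have h2 := S.pole.im_ne_zero
  apply Complex.ext
  · rw [Complex.re_ofReal_mul]
    simp
    field_simp
    ring
  · rw [Complex.im_ofReal_mul]
    simp
    field_simp
    ring

/-- There is a polar-coordinate system with its pole on the polar axis of `S` at distance `D` from
the pole of `S` and with its axis pointing away from that pole. The hyperboloid coordinates change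
by a Lorentz boost. -/
theorem exists_boost (S : PolarSystem) (D : ℝ) :
    ∃ S' : PolarSystem, ∀ p,
      Real.cosh (S'.radius p) =
        Real.cosh D * Real.cosh (S.radius p) - Real.sinh D * (S.spatial p).re ∧
      (S'.spatial p).re =
        Real.cosh D * (S.spatial p).re - Real.sinh D * Real.cosh (S.radius p) ∧
      (S'.spatial p).im = (S.spatial p).im := by
  obtain ⟨o', ho'⟩ := S.spatial_surjective (Real.sinh D : ℂ)
  have hch : Real.cosh (S.radius o') = Real.cosh D := by
    have h1 := S.cosh_radius_sq o'
    rw [ho', Complex.ofReal_re, Complex.ofReal_im] at h1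
    have h2 := Real.cosh_sq D
    rw [← sq_eq_sq₀ (Real.cosh_pos _).le (Real.cosh_pos _).le]
    linarith
  have hu := S.dir_mul_conj
  have hid := S.spatial_mul_sub_conj_pole o'
  rw [ho', hch] at hid
  set u : ℂ := (S.dir : ℂ) with hudef
  have hu0 : u ≠ 0 := Circle.coe_ne_zero _
  have hlt : |Real.sinh D| < 1 + Real.cosh D := by
    rw [abs_lt]
    have := Real.cosh_sq D
    have := Real.cosh_pos D
    constructor <;> nlinarith
  -- numerator and denominator of the factor by which the boost turns the direction of the axis
  set e : ℂ := (1 + Real.cosh D : ℂ) - Real.sinh D * u with he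
  have he0 : e ≠ 0 := by
    intro h
    have h1 : ((1 + Real.cosh D : ℝ) : ℂ) = Real.sinh D * u := by
      rw [Complex.ofReal_add, Complex.ofReal_one]; linear_combination h
    have h2 := congrArg (‖·‖) h1
    simp only [norm_mul, Complex.norm_real, hudef, Circle.norm_coe, mul_one, Real.norm_eq_abs] at h2
    rw [abs_of_pos (by have := Real.cosh_pos D; linarith)] at h2
    linarith
  have hd : u * (starRingEnd ℂ) e / e ∈ Submonoid.unitSphere ℂ := by
    refine mem_sphere_zero_iff_norm.mpr ?_
    have hu1 : ‖u‖ = 1 := Circle.norm_coe _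
    simp [hu1, he0]
  set S' : PolarSystem := ⟨o', ⟨u * (starRingEnd ℂ) e / e, hd⟩⟩ with hS'
  have hrad : ∀ p, Real.cosh (S'.radius p) =
      Real.cosh D * Real.cosh (S.radius p) - Real.sinh D * (S.spatial p).re := by
    intro p
    change Real.cosh (dist p o') = _
    rw [S.cosh_dist, ho', hch, Complex.ofReal_re, Complex.ofReal_im]
    ring
  refine ⟨S', fun p => ?_⟩
  suffices h : S'.spatial p =
      ⟨Real.cosh D * (S.spatial p).re - Real.sinh D * Real.cosh (S.radius p),
        (S.spatial p).im⟩ by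
    refine ⟨hrad p, ?_, ?_⟩ <;> rw [h]
  have hp := S.spatial_mul_sub_conj_pole p
  have hp' := S'.spatial_mul_sub_conj_pole p
  rw [hrad p] at hp'
  have hne : ∀ q : UpperHalfPlane, ((p : ℂ) - (starRingEnd ℂ) (q : ℂ)) ≠ 0 := by
    intro q h
    have := congrArg Complex.im h
    simp at this
    linarith [p.im_pos, q.im_pos]
  have hec : (starRingEnd ℂ) e = (1 + Real.cosh D : ℂ) - Real.sinh D * (starRingEnd ℂ) u := by
    simp only [he, map_sub, map_add, map_mul, map_one, Complex.conj_ofReal]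
  have hec0 : (starRingEnd ℂ) e ≠ 0 := by simpa using he0
  have hidc := congrArg (starRingEnd ℂ) hid
  simp only [map_sub, map_add, map_mul, map_one, Complex.conj_ofReal, Complex.conj_conj] at hidc
  have hdir : (S'.dir : ℂ) = u * (starRingEnd ℂ) e / e := rfl
  have hpole : (S'.pole : ℂ) = o' := rfl
  rw [hdir, hpole] at hp'
  set T : ℂ := ⟨Real.cosh D * (S.spatial p).re - Real.sinh D * Real.cosh (S.radius p),
      (S.spatial p).im⟩ with hT
  -- the Möbius transformation `w ↦ (w - t) / (1 - t w)` in hyperboloid coordinates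
  have key : (1 + (Real.cosh D * Real.cosh (S.radius p) - Real.sinh D * (S.spatial p).re : ℝ) : ℂ) *
      ((1 + Real.cosh D) * S.spatial p - Real.sinh D * (1 + Real.cosh (S.radius p))) =
      T * ((1 + Real.cosh D) * (1 + Real.cosh (S.radius p)) - Real.sinh D * S.spatial p) := by
    have h1 := S.cosh_radius_sq p
    have h2 := Real.cosh_sq D
    generalize Real.cosh (S.radius p) = X at *
    generalize Real.cosh D = C at *
    generalize Real.sinh D = s at *
    rw [hT]
    apply Complex.ext
    · simp
      linear_combination s * h1 - (S.spatial p).re * h2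
    · simp
      linear_combination (S.spatial p).im * X * h2
  have hX0 : (1 + Real.cosh (S.radius p) : ℂ) ≠ 0 := by
    rw [← Complex.ofReal_one, ← Complex.ofReal_add]
    exact_mod_cast (by have := Real.cosh_pos (S.radius p); linarith)
  have h3 : (S'.spatial p - T) * (u * (starRingEnd ℂ) e * ((p : ℂ) - (starRingEnd ℂ) (o' : ℂ)) *
      (1 + Real.cosh (S.radius p))) = 0 := by
    have h4 : e * ((p : ℂ) - o') = (1 + Real.cosh D) * ((p : ℂ) - S.pole) -
        Real.sinh D * u * ((p : ℂ) - (starRingEnd ℂ) (S.pole : ℂ)) := by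
      rw [he]; linear_combination -hid
    have h5 : u * (starRingEnd ℂ) e * ((p : ℂ) - (starRingEnd ℂ) (o' : ℂ)) =
        u * (1 + Real.cosh D) * ((p : ℂ) - (starRingEnd ℂ) (S.pole : ℂ)) -
        Real.sinh D * ((p : ℂ) - S.pole) := by
      rw [hec]
      linear_combination -u * hidc - Real.sinh D * ((p : ℂ) - S.pole) * hu
    have h6 : S'.spatial p * (u * (starRingEnd ℂ) e * ((p : ℂ) - (starRingEnd ℂ) (o' : ℂ))) =
        (1 + (Real.cosh D * Real.cosh (S.radius p) - Real.sinh D * (S.spatial p).re : ℝ)) *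
          (e * ((p : ℂ) - o')) := by
      field_simp at hp'
      linear_combination -hp'
    rw [h4] at h6
    linear_combination (1 + Real.cosh (S.radius p)) * h6 -
      (1 + Real.cosh (S.radius p)) * T * h5 +
      u * ((p : ℂ) - (starRingEnd ℂ) (S.pole : ℂ)) * key +
      ((1 + (Real.cosh D * Real.cosh (S.radius p) - Real.sinh D * (S.spatial p).re : ℝ)) *
        (1 + Real.cosh D) + T * Real.sinh D) * hp
  rcases mul_eq_zero.mp h3 with h | h
  · exact sub_eq_zero.mp h
  · exact absurd h (mul_ne_zero (mul_ne_zero (mul_ne_zero hu0 hec0) (hne o')) hX0)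

/-! ### Angular intervals of disks and midpoints -/

theorem continuous_spatial (S : PolarSystem) : Continuous S.spatial := by
  unfold spatial
  have h1 := UpperHalfPlane.continuous_coe
  have h2 : Continuous fun p : UpperHalfPlane => (p.im : ℂ) :=
    Complex.continuous_ofReal.comp UpperHalfPlane.continuous_im
  refine Continuous.div_const (Continuous.div ?_ ?_ ?_) _
  · exact (h1.sub continuous_const).mul ((Complex.continuous_conj.comp h1).sub continuous_const)
  · exact (continuous_const.mul h2).mul continuous_const
  · intro p
    have := p.im_ne_zero
    have := S.pole.im_ne_zero
    simp [*]

theorem isConnected_closedBall (c : UpperHalfPlane) {r : ℝ} (hr : 0 ≤ r) :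
    IsConnected (Metric.closedBall c r) := by
  refine ⟨⟨c, Metric.mem_closedBall_self hr⟩, ?_⟩
  rw [← UpperHalfPlane.isEmbedding_coe.isInducing.isPreconnected_image,
    UpperHalfPlane.image_coe_closedBall]
  exact (convex_closedBall _ _).isPreconnected

/-- A disk that does not meet the polar axis is seen from the pole in an interval of angles. -/
theorem image_angle_eq_Icc {S : PolarSystem} {c : UpperHalfPlane} {r : ℝ} (hr : 0 ≤ r)
    (h : Disjoint (Metric.closedBall c r) (S.ray 0)) :
    S.angle '' Metric.closedBall c r = Set.Icc (S.angleInf c r) (S.angleSup c r) := by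
  have hc : ContinuousOn S.angle (Metric.closedBall c r) := by
    have : S.angle = argIco ∘ S.spatial := funext S.angle_eq_argIco
    rw [this]
    refine continuousOn_argIco.comp S.continuous_spatial.continuousOn fun p hp => ?_
    have hp0 : S.angle p ≠ 0 := fun h0 => Set.disjoint_left.mp h hp h0
    rw [angle_eq_argIco, Ne, argIco_eq_zero_iff, not_and_or, not_le] at hp0
    rw [Set.mem_ofPred_eq, Complex.mem_slitPlane_iff]
    simpa using hp0
  exact eq_Icc_of_connected_compact ((isConnected_closedBall c hr).image _ hc)
    ((isCompact_closedBall c r).image_of_continuousOn hc)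

end PolarSystem

theorem UpperHalfPlane.exists_midpoint (p q : UpperHalfPlane) :
    ∃ m : UpperHalfPlane, dist p m = dist p q / 2 ∧ dist q m = dist p q / 2 := by
  set S := PolarSystem.standard
  have hN : 0 < 2 + 2 * Real.cosh (dist p q) := by have := Real.cosh_pos (dist p q); linarith
  set N := Real.sqrt (2 + 2 * Real.cosh (dist p q)) with hNdef
  have hN0 : 0 < N := Real.sqrt_pos.mpr hN
  have hN2 : N ^ 2 = 2 + 2 * Real.cosh (dist p q) := Real.sq_sqrt hN.le
  have hhalf : N = 2 * Real.cosh (dist p q / 2) := by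
    rw [← sq_eq_sq₀ hN0.le (by have := Real.cosh_pos (dist p q / 2); linarith), hN2, mul_pow]
    have h1 := Real.cosh_two_mul (dist p q / 2)
    have h2 := Real.cosh_sq (dist p q / 2)
    rw [mul_div_cancel₀ _ two_ne_zero] at h1
    linarith
  -- in the hyperboloid model the midpoint is the normalized sum of the endpoints
  obtain ⟨m, hm⟩ := S.spatial_surjective ((S.spatial p + S.spatial q) / N)
  have hre : (S.spatial m).re = ((S.spatial p).re + (S.spatial q).re) / N := by
    rw [hm, Complex.div_ofReal_re, Complex.add_re]
  have him : (S.spatial m).im = ((S.spatial p).im + (S.spatial q).im) / N := by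
    rw [hm, Complex.div_ofReal_im, Complex.add_im]
  have h1 := S.cosh_radius_sq p
  have h2 := S.cosh_radius_sq q
  have h3 := S.cosh_dist p q
  have hX : Real.cosh (S.radius m) = (Real.cosh (S.radius p) + Real.cosh (S.radius q)) / N := by
    have := Real.cosh_pos (S.radius p)
    have := Real.cosh_pos (S.radius q)
    rw [← sq_eq_sq₀ (Real.cosh_pos _).le (by positivity), S.cosh_radius_sq, hre, him]
    field_simp
    rw [hN2, h3]
    linear_combination -h1 - h2
  have key : ∀ x : UpperHalfPlane, Real.cosh (dist x m) = Real.cosh (dist p q / 2) →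
      dist x m = dist p q / 2 := fun x hx =>
    Real.cosh_strictMonoOn.injOn dist_nonneg (by positivity : (0 : ℝ) ≤ dist p q / 2) hx
  refine ⟨m, key p ?_, key q ?_⟩
  all_goals
    rw [S.cosh_dist, hX, hre, him, ← mul_left_cancel_iff_of_pos (two_pos (α := ℝ)), ← hhalf,
      ← mul_left_cancel_iff_of_pos hN0, ← sq, hN2, h3]
    field_simp
  · linear_combination h1
  · linear_combination h2

/-! ### Packing disks along a ray -/

/-- Coordinates adapted to the line that carries the ray with polar angle `z`: `h` is the signed
distance from the line, `s` the position along the line, measured from the pole, of the foot of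
the perpendicular. -/
theorem PolarSystem.exists_fermi_coordinates (S : PolarSystem) (z : ℝ) :
    ∃ h s : UpperHalfPlane → ℝ,
      (∀ p, Real.cosh (S.radius p) = Real.cosh (h p) * Real.cosh (s p)) ∧
      (∀ p q, Real.cosh (dist p q) =
        Real.cosh (h p) * Real.cosh (h q) * Real.cosh (s p - s q) -
          Real.sinh (h p) * Real.sinh (h q)) ∧
      ∀ p, S.angle p = z → h p = 0 ∧ s p = S.radius p := by
  set x : UpperHalfPlane → ℝ := fun p =>
    (S.spatial p).re * Real.cos z + (S.spatial p).im * Real.sin z with hx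
  set y : UpperHalfPlane → ℝ := fun p =>
    (S.spatial p).im * Real.cos z - (S.spatial p).re * Real.sin z with hy
  have hz := Real.sin_sq_add_cos_sq z
  have hX : ∀ p, Real.cosh (S.radius p) ^ 2 = 1 + x p ^ 2 + y p ^ 2 := fun p => by
    rw [S.cosh_radius_sq]
    simp only [hx, hy]
    linear_combination -((S.spatial p).re ^ 2 + (S.spatial p).im ^ 2) * hz
  set h : UpperHalfPlane → ℝ := fun p => Real.arsinh (y p) with hh
  set s : UpperHalfPlane → ℝ := fun p => Real.arsinh (x p / Real.cosh (h p)) with hs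
  have hhy : ∀ p, Real.sinh (h p) = y p := fun p => Real.sinh_arsinh _
  have hsx : ∀ p, Real.cosh (h p) * Real.sinh (s p) = x p := fun p => by
    have := Real.cosh_pos (h p)
    rw [hs]
    simp only [Real.sinh_arsinh]
    field_simp
  have hrad : ∀ p, Real.cosh (S.radius p) = Real.cosh (h p) * Real.cosh (s p) := fun p => by
    have h1 := Real.cosh_pos (h p)
    have h2 := Real.cosh_pos (s p)
    rw [← sq_eq_sq₀ (Real.cosh_pos _).le (by positivity), mul_pow, hX, Real.cosh_sq (s p), mul_add,
      ← mul_pow, hsx, mul_one, Real.cosh_sq (h p), hhy]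
    ring
  refine ⟨h, s, hrad, fun p q => ?_, fun p hp => ?_⟩
  · rw [S.cosh_dist, hrad, hrad, Real.cosh_sub, hhy, hhy]
    have h1 : (S.spatial p).re * (S.spatial q).re + (S.spatial p).im * (S.spatial q).im =
        x p * x q + y p * y q := by
      simp only [hx, hy]
      linear_combination -((S.spatial p).re * (S.spatial q).re +
        (S.spatial p).im * (S.spatial q).im) * hz
    rw [h1, ← hsx p, ← hsx q]
    ring
  · have hre := (S.isCoord_radius_angle p).re_spatial
    have him := (S.isCoord_radius_angle p).im_spatial
    rw [hp] at hre him
    have hy0 : y p = 0 := by simp only [hy, hre, him]; ring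
    have hx0 : x p = Real.sinh (S.radius p) := by
      simp only [hx, hre, him]; linear_combination Real.sinh (S.radius p) * hz
    have hh0 : h p = 0 := by simp [hh, hy0]
    refine ⟨hh0, ?_⟩
    simp only [hs, hh0, hx0, Real.cosh_zero, div_one, Real.arsinh_sinh]

theorem Real.tanh_pos_of_pos {r : ℝ} (hr : 0 < r) : 0 < Real.tanh r := by
  rw [Real.tanh_eq_sinh_div_cosh]
  exact div_pos (Real.sinh_pos_iff.mpr hr) (Real.cosh_pos r)

theorem Real.cosh_sub_one_le_sq {x : ℝ} (hx : x ^ 2 ≤ 1) : Real.cosh x - 1 ≤ x ^ 2 := by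
  have h1 := Real.cosh_le_exp_half_sq x
  have h2 := Real.abs_exp_sub_one_sub_id_le (x := x ^ 2 / 2) (by
    rw [abs_of_nonneg (by positivity)]; linarith)
  rw [abs_le] at h2
  nlinarith [sq_nonneg x]

/-- Two points on the same side of a line and within distance `r` of it have distance at most `2 r`
if their feet on the line have distance at most `tanh r`. -/
theorem fermi_cosh_le {r h h' d : ℝ} (hr : 0 < r) (hd : |d| ≤ Real.tanh r)
    (h1 : |h| ≤ r) (h1' : |h'| ≤ r) (h2 : |h - h'| ≤ r) :
    Real.cosh h * Real.cosh h' * Real.cosh d - Real.sinh h * Real.sinh h' ≤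
      Real.cosh (2 * r) := by
  have ht := Real.tanh_pos_of_pos hr
  have hc := Real.cosh_pos r
  have htc : Real.tanh r * Real.cosh r = Real.sinh r := by
    rw [Real.tanh_eq_sinh_div_cosh]; field_simp
  have hcs := Real.cosh_sq r
  have ht1 : Real.tanh r ^ 2 ≤ 1 := by
    have : (Real.tanh r * Real.cosh r) ^ 2 ≤ Real.cosh r ^ 2 := by rw [htc]; linarith
    rw [mul_pow] at this
    exact le_of_mul_le_mul_right (by linarith) (by positivity : 0 < Real.cosh r ^ 2)
  have hd2 : d ^ 2 ≤ Real.tanh r ^ 2 := by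
    rw [← sq_abs d]; exact pow_le_pow_left₀ (abs_nonneg _) hd 2
  have e1 : Real.cosh d - 1 ≤ Real.tanh r ^ 2 :=
    (Real.cosh_sub_one_le_sq (hd2.trans ht1)).trans hd2
  have e2 : Real.cosh h ≤ Real.cosh r := Real.cosh_le_cosh.mpr (by rwa [abs_of_pos hr])
  have e3 : Real.cosh h' ≤ Real.cosh r := Real.cosh_le_cosh.mpr (by rwa [abs_of_pos hr])
  have e4 : Real.cosh (h - h') ≤ Real.cosh r := Real.cosh_le_cosh.mpr (by rwa [abs_of_pos hr])
  have e5 : Real.cosh h * Real.cosh h' ≤ Real.cosh r ^ 2 := by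
    rw [sq]; exact mul_le_mul e2 e3 (Real.cosh_pos _).le hc.le
  have e6 : Real.cosh h * Real.cosh h' * (Real.cosh d - 1) ≤ Real.sinh r ^ 2 := by
    rw [← htc, mul_pow, mul_comm (Real.tanh r ^ 2)]
    exact mul_le_mul e5 e1 (by linarith [Real.one_le_cosh d]) (by positivity)
  have e7 := Real.one_le_cosh r
  rw [Real.cosh_sub] at e4
  rw [Real.cosh_two_mul]
  nlinarith

/-- Disks of radius `r` that meet a common ray, do not contain the pole, have their centers in an
annulus of width `2 r` and have centers at pairwise distance greater than `2 r`: on each side of the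
ray, the feet of the centers on the ray lie in an interval of length `3 r` and have pairwise
distance greater than `tanh r`. -/
theorem card_le_of_meet_ray {V : Type*} (S : PolarSystem) {r a z : ℝ} (hr : 0 < r)
    (c : V → UpperHalfPlane) (I : Finset V)
    (hsep : ∀ u ∈ I, ∀ v ∈ I, u ≠ v → 2 * r < dist (c u) (c v))
    (hann : ∀ v ∈ I, a < S.radius (c v) ∧ S.radius (c v) ≤ a + 2 * r)
    (hpole : ∀ v ∈ I, r < S.radius (c v))
    (hray : ∀ v ∈ I, (Metric.closedBall (c v) r ∩ S.ray z).Nonempty) :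
    I.card ≤ 6 * ⌈r / Real.tanh r⌉₊ := by
  obtain ⟨h, s, hrad, hdist, hz⟩ := S.exists_fermi_coordinates z
  have ht := Real.tanh_pos_of_pos hr
  have key : ∀ v ∈ I, |h (c v)| ≤ r ∧ a - r < s (c v) ∧ s (c v) ≤ a + 2 * r := by
    intro v hv
    obtain ⟨q, hq, hqz⟩ := hray v hv
    obtain ⟨hq0, hqs⟩ := hz q hqz
    have hd : Real.cosh (dist q (c v)) ≤ Real.cosh r :=
      Real.cosh_le_cosh.mpr (by rwa [abs_of_nonneg dist_nonneg, abs_of_pos hr])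
    rw [hdist, hq0, hqs, Real.cosh_zero, Real.sinh_zero, one_mul, zero_mul, sub_zero] at hd
    have g1 := Real.one_le_cosh (S.radius q - s (c v))
    have g2 := Real.one_le_cosh (h (c v))
    have g3 : Real.cosh (h (c v)) ≤ Real.cosh r := by nlinarith
    have hR := hrad (c v)
    have hR0 := S.radius_nonneg (c v)
    have hs0 : 0 ≤ s (c v) := by
      by_contra hneg
      push Not at hneg
      have g4 : Real.cosh (s (c v)) ≤ Real.cosh (S.radius q - s (c v)) := by
        have := S.radius_nonneg q
        rw [Real.cosh_le_cosh, abs_of_neg hneg, abs_of_nonneg (by linarith)]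
        linarith
      have g5 : Real.cosh (S.radius (c v)) ≤ Real.cosh r := by
        rw [hR]; exact (mul_le_mul_of_nonneg_left g4 (by linarith)).trans hd
      rw [Real.cosh_le_cosh, abs_of_nonneg hR0, abs_of_pos hr] at g5
      linarith [hpole v hv]
    refine ⟨?_, ?_, ?_⟩
    · rwa [Real.cosh_le_cosh, abs_of_pos hr] at g3
    · have g4 : Real.cosh (S.radius (c v)) ≤ Real.cosh (r + s (c v)) := by
        rw [hR, Real.cosh_add]
        have := Real.cosh_pos (s (c v))
        have := mul_nonneg (Real.sinh_nonneg_iff.mpr hr.le) (Real.sinh_nonneg_iff.mpr hs0)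
        nlinarith
      rw [Real.cosh_le_cosh, abs_of_nonneg hR0, abs_of_nonneg (by linarith)] at g4
      linarith [(hann v hv).1]
    · have g4 : Real.cosh (s (c v)) ≤ Real.cosh (S.radius (c v)) := by
        have := Real.cosh_pos (s (c v))
        rw [hR]; nlinarith
      rw [Real.cosh_le_cosh, abs_of_nonneg hR0, abs_of_nonneg hs0] at g4
      linarith [(hann v hv).2]
  set K := ⌈r / Real.tanh r⌉₊ with hK
  -- the side of the ray and the cell of the foot in a subdivision into cells of length `tanh r`
  set f : V → Bool × ℕ := fun v =>
    (decide (0 ≤ h (c v)), ⌈(s (c v) - (a - r)) / Real.tanh r⌉₊) with hf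
  have hcard : I.card ≤ ((Finset.univ : Finset Bool) ×ˢ Finset.Icc 1 (3 * K)).card := by
    refine Finset.card_le_card_of_injOn f ?_ ?_
    · intro v hv
      obtain ⟨-, k2, k3⟩ := key v hv
      simp only [hf, Finset.coe_product, Set.mem_prod, Finset.coe_univ, Set.mem_univ, true_and,
        Finset.coe_Icc, Set.mem_Icc]
      constructor
      · exact Nat.ceil_pos.mpr (div_pos (by linarith) ht)
      · rw [Nat.ceil_le]
        have := Nat.le_ceil (r / Real.tanh r)
        rw [← hK, div_le_iff₀ ht] at this
        rw [div_le_iff₀ ht]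
        push_cast
        linarith
    · intro u hu v hv huv
      by_contra hne
      have hsep' := hsep u hu v hv hne
      obtain ⟨k1, k2, k3⟩ := key u hu
      obtain ⟨l1, l2, l3⟩ := key v hv
      simp only [hf, Prod.mk.injEq, decide_eq_decide] at huv
      obtain ⟨hside, hcell⟩ := huv
      have m1 := Nat.le_ceil ((s (c u) - (a - r)) / Real.tanh r)
      have m2 := Nat.ceil_lt_add_one (div_pos (by linarith : 0 < s (c u) - (a - r)) ht).le
      have m3 := Nat.le_ceil ((s (c v) - (a - r)) / Real.tanh r)
      have m4 := Nat.ceil_lt_add_one (div_pos (by linarith : 0 < s (c v) - (a - r)) ht).le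
      rw [hcell] at m1 m2
      have hdiff : |s (c u) - s (c v)| ≤ Real.tanh r := by
        have e : (s (c u) - s (c v)) =
          ((s (c u) - (a - r)) / Real.tanh r - (s (c v) - (a - r)) / Real.tanh r) *
            Real.tanh r := by field_simp; ring
        rw [e, abs_mul, abs_of_pos ht]
        have : |(s (c u) - (a - r)) / Real.tanh r - (s (c v) - (a - r)) / Real.tanh r| ≤ 1 := by
          rw [abs_le]; constructor <;> linarith
        nlinarith
      have hh : |h (c u) - h (c v)| ≤ r := by
        rw [abs_le] at k1 l1 ⊢
        by_cases h0 : 0 ≤ h (c u)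
        · have := hside.mp h0
          constructor <;> linarith
        · have h0' : ¬ 0 ≤ h (c v) := fun h' => h0 (hside.mpr h')
          constructor <;> linarith
      have hle := fermi_cosh_le hr hdiff k1 l1 hh
      rw [← hdist, Real.cosh_le_cosh, abs_of_nonneg dist_nonneg, abs_of_pos (by linarith)] at hle
      linarith
  rw [Finset.card_product, Nat.card_Icc, Finset.card_univ, Fintype.card_bool] at hcard
  omega

theorem closedBall_inter_nonempty_iff (p q : UpperHalfPlane) (r : ℝ) :
    (Metric.closedBall p r ∩ Metric.closedBall q r).Nonempty ↔ dist p q ≤ 2 * r := by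
  constructor
  · rintro ⟨x, hp, hq⟩
    have := dist_triangle_left p q x
    rw [Metric.mem_closedBall] at hp hq
    linarith
  · intro h
    obtain ⟨m, h1, h2⟩ := UpperHalfPlane.exists_midpoint p q
    refine ⟨m, ?_, ?_⟩ <;> rw [Metric.mem_closedBall, dist_comm] <;> linarith

/-! ### Paths as trees -/

theorem SimpleGraph.pathGraph_isTree {m : ℕ} (hm : 0 < m) : (SimpleGraph.pathGraph m).IsTree := by
  obtain ⟨k, rfl⟩ : ∃ k, m = k + 1 := ⟨m - 1, by omega⟩
  refine ⟨SimpleGraph.pathGraph_connected k, ?_⟩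
  rw [SimpleGraph.isAcyclic_iff_forall_adj_isBridge]
  intro u v huv
  rw [SimpleGraph.isBridge_iff]
  intro hreach
  rw [SimpleGraph.pathGraph_adj] at huv
  -- without the edge `uv` no walk leaves the initial segment that ends at `min u v`
  have inv : ∀ x y, ((SimpleGraph.pathGraph (k + 1)).deleteEdges {s(u, v)}).Reachable x y →
      ((x : ℕ) ≤ min (u : ℕ) v ↔ (y : ℕ) ≤ min (u : ℕ) v) := by
    rintro x y ⟨w⟩
    induction w with
    | nil => rfl
    | cons h _ ih =>
      rw [← ih]
      rw [SimpleGraph.deleteEdges_adj, SimpleGraph.pathGraph_adj] at h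
      obtain ⟨h1, h2⟩ := h
      simp only [Set.mem_singleton_iff, Sym2.eq_iff, Fin.ext_iff] at h2
      omega
  have := inv u v hreach
  omega

theorem SimpleGraph.connected_induce_pathGraph_Icc {m a b : ℕ} (hab : a ≤ b) (hb : b < m) :
    ((SimpleGraph.pathGraph m).induce {t : Fin m | a ≤ t ∧ (t : ℕ) ≤ b}).Connected := by
  set s := {t : Fin m | a ≤ t ∧ (t : ℕ) ≤ b}
  have ha : (⟨a, by omega⟩ : Fin m) ∈ s := ⟨le_rfl, hab⟩
  have key : ∀ (d : ℕ) (h : a + d ≤ b), ((SimpleGraph.pathGraph m).induce s).Reachable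
      ⟨⟨a, by omega⟩, ha⟩ ⟨⟨a + d, by omega⟩, ⟨Nat.le_add_right _ _, h⟩⟩ := by
    intro d
    induction d with
    | zero => intro h; exact SimpleGraph.Reachable.refl _
    | succ d ih =>
      intro h
      refine (ih (by omega)).trans (SimpleGraph.Adj.reachable ?_)
      rw [SimpleGraph.induce_adj, SimpleGraph.pathGraph_adj]
      left
      simp only
      omega
  have key' : ∀ x, ((SimpleGraph.pathGraph m).induce s).Reachable ⟨⟨a, by omega⟩, ha⟩ x := by
    rintro ⟨⟨x, hx⟩, hx1, hx2⟩
    obtain ⟨d, rfl⟩ := Nat.exists_eq_add_of_le hx1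
    exact key d hx2
  exact { preconnected := fun x y => (key' x).symm.trans (key' y), nonempty := ⟨⟨_, ha⟩⟩ }

theorem SimpleGraph.indepNum_induce_le {V : Type*} [Finite V] (G : SimpleGraph V) (s : Set V)
    (k : ℕ) : (G.induce s).indepNum ≤ k ↔
      ∀ I : Finset V, ↑I ⊆ s → G.IsIndepSet I → I.card ≤ k := by
  constructor
  · intro h I hI hind
    classical
    let J : Finset s := I.subtype (· ∈ s)
    have hJ : J.map (Function.Embedding.subtype _) = I :=
      Finset.subtype_map_of_mem fun x hx => hI hx
    rw [← hJ, Finset.card_map]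
    refine le_trans (SimpleGraph.IsIndepSet.card_le_indepNum ?_) h
    intro x hx y hy hxy
    rw [SimpleGraph.induce_adj]
    exact hind (by simpa [J] using hx) (by simpa [J] using hy) (fun h => hxy (Subtype.ext h))
  · intro h
    obtain ⟨J, hJ, hcard⟩ := (G.induce s).exists_isNIndepSet_indepNum
    rw [← hcard, ← Finset.card_map (Function.Embedding.subtype _)]
    apply h
    · intro x hx
      simp at hx
      exact hx.1
    · intro x hx y hy hxy
      simp only [Finset.coe_map, Function.Embedding.subtype_apply, Set.mem_image] at hx hy
      obtain ⟨x, hx, rfl⟩ := hx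
      obtain ⟨y, hy, rfl⟩ := hy
      have := hJ hx hy (fun h => hxy (congrArg _ h))
      exact this

/-! ### The angular sweep and the annular layering -/

section Sweep

variable {n : ℕ} {S : PolarSystem} {r : ℝ} {c : Fin n → UpperHalfPlane}

/-- A disk meets exactly the rays whose polar angles lie between its extreme polar angles. -/
theorem mem_ray_inter_iff (hr : 0 < r)
    (hdis : ∀ v, Disjoint (Metric.closedBall (c v) r) (S.ray 0)) (v : Fin n) (x : ℝ) :
    (Metric.closedBall (c v) r ∩ S.ray x).Nonempty ↔
      S.angleInf (c v) r ≤ x ∧ x ≤ S.angleSup (c v) r := by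
  rw [← Set.mem_Icc, ← PolarSystem.image_angle_eq_Icc hr.le (hdis v)]
  rfl

theorem angleInf_le_angleSup (hr : 0 < r)
    (hdis : ∀ v, Disjoint (Metric.closedBall (c v) r) (S.ray 0)) (v : Fin n) :
    S.angleInf (c v) r ≤ S.angleSup (c v) r := by
  have h := ((mem_ray_inter_iff hr hdis v (S.angle (c v))).mp
    ⟨c v, Metric.mem_closedBall_self hr.le, rfl⟩)
  exact h.1.trans h.2

theorem lt_radius_of_disjoint_ray
    (hdis : ∀ v, Disjoint (Metric.closedBall (c v) r) (S.ray 0)) (v : Fin n) :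
    r < S.radius (c v) := by
  by_contra h
  push Not at h
  have hmem : S.pole ∈ Metric.closedBall (c v) r := by rwa [Metric.mem_closedBall, dist_comm]
  refine Set.disjoint_left.mp (hdis v) hmem ?_
  change S.angle S.pole = 0
  rw [PolarSystem.angle_eq_argIco]
  simp [PolarSystem.spatial, argIco_eq_zero_iff]

/-- The layer is computed by rounding up; layer `0` is empty since no center is at the pole. -/
theorem isAnnularLayering_ceil (hr : 0 < r) {lay : Fin n → ℕ}
    (hlay : ∀ v, lay v = ⌈S.radius (c v) / (2 * r)⌉₊)
    (hpos : ∀ v, 0 < S.radius (c v)) :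
    IsAnnularLayering S r c (fun i => {v | lay v = i}) := by
  intro i
  ext v
  have h2 : (0 : ℝ) < 2 * r := by linarith
  have h1 := hlay v
  simp only [Set.mem_ofPred_eq]
  constructor
  · rintro rfl
    have h3 := Nat.le_ceil (S.radius (c v) / (2 * r))
    have h4 := Nat.ceil_lt_add_one (div_pos (hpos v) h2).le
    rw [← h1] at h3 h4
    rw [div_le_iff₀ h2] at h3
    rw [← sub_lt_iff_lt_add, lt_div_iff₀ h2] at h4
    constructor <;> linarith
  · rintro ⟨h3, h4⟩
    rw [h1]
    have hi : i ≠ 0 := by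
      rintro rfl
      have := hpos v
      simp at h4
      linarith
    rw [Nat.ceil_eq_iff hi, div_le_iff₀ h2, lt_div_iff₀ h2]
    rw [Nat.cast_sub (by omega)]
    push_cast
    constructor <;> linarith

theorem isLayering_of_isAnnularLayering {G : SimpleGraph (Fin n)} (hr : 0 < r)
    (hG : IsDiskRealization G r c) {lay : Fin n → ℕ}
    (h : IsAnnularLayering S r c (fun i => {v | lay v = i})) :
    IsLayering G (fun i => {v | lay v = i}) where
  disjoint i j hij := Set.disjoint_left.mpr fun v h1 h2 => hij (h1.symm.trans h2)
  iUnion_eq := Set.eq_univ_of_forall fun v => Set.mem_iUnion.mpr ⟨lay v, rfl⟩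
  eventually_empty := by
    refine ⟨Finset.univ.sup lay + 1, fun i hi => Set.eq_empty_of_forall_notMem fun v hv => ?_⟩
    have := Finset.le_sup (f := lay) (Finset.mem_univ v)
    have hv' : lay v = i := hv
    omega
  adj u v huv i j hu hv := by
    have hd := (closedBall_inter_nonempty_iff _ _ _).mp ((hG u v).mp huv).2
    have hu' : u ∈ {v | lay v = i} := hu
    have hv' : v ∈ {v | lay v = j} := hv
    have key : ∀ (u v : Fin n) (i j : ℕ), dist (c u) (c v) ≤ 2 * r →
        u ∈ {v | lay v = i} → v ∈ {v | lay v = j} → i ≤ j + 1 := by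
      intro u v i j hd hu hv
      rw [show {v | lay v = i} = _ from h i] at hu
      rw [show {v | lay v = j} = _ from h j] at hv
      obtain ⟨h1, h2⟩ := hu
      obtain ⟨h3, h4⟩ := hv
      have h5 : S.radius (c u) ≤ dist (c u) (c v) + S.radius (c v) := dist_triangle _ _ _
      by_contra hlt
      push Not at hlt
      have h6 : (j : ℝ) + 2 ≤ i := by exact_mod_cast hlt
      nlinarith
    exact ⟨key u v i j hd hu' hv', key v u j i (by rwa [dist_comm]) hv' hu'⟩

/-- The packing bound, applied to the disks of an independent set that share a bag and a layer. -/
theorem witnessLayered_of_sweep {m : ℕ} {G : SimpleGraph (Fin n)} (hr : 0 < r)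
    (hG : IsDiskRealization G r c) {bag : Fin m → Set (Fin n)} {L : ℕ → Set (Fin n)}
    (hbag : IsAngularSweep S r c bag) (hL : IsAnnularLayering S r c L) :
    WitnessLayered G bag L (6 * ⌈r / Real.tanh r⌉₊) := by
  obtain ⟨hdis, z, -, -, hz⟩ := hbag
  intro t i
  rw [SimpleGraph.indepNum_induce_le]
  intro I hI hind
  have hmem : ∀ v ∈ I, v ∈ bag t ∧ v ∈ L i := fun v hv => hI hv
  refine card_le_of_meet_ray S (a := (2 * (i : ℝ) - 2) * r) (z := z t) hr c I ?_ ?_ ?_ ?_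
  · intro u hu v hv huv
    by_contra hle
    push Not at hle
    exact hind hu hv huv ((hG u v).mpr ⟨huv, (closedBall_inter_nonempty_iff _ _ _).mpr hle⟩)
  · intro v hv
    have := (hmem v hv).2
    rw [hL i] at this
    exact ⟨this.1, this.2.trans (by linarith)⟩
  · exact fun v _ => lt_radius_of_disjoint_ray hdis v
  · intro v hv
    have := (hmem v hv).1
    rw [hz t] at this
    exact this

variable {m : ℕ} {z : Fin m → ℝ} {first last : Fin n → Fin m}

theorem isAngularSweep_of_rank (hr : 0 < r)
    (hdis : ∀ v, Disjoint (Metric.closedBall (c v) r) (S.ray 0)) (hz : StrictMono z)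
    (hrange : ∀ k, ∃ v, k = first v ∨ k = last v)
    (hfirst : ∀ v, z (first v) = S.angleInf (c v) r)
    (hlast : ∀ v, z (last v) = S.angleSup (c v) r) :
    IsAngularSweep S r c (fun k => {v | first v ≤ k ∧ k ≤ last v}) := by
  refine ⟨hdis, z, hz, ?_, fun k => ?_⟩
  · ext x
    constructor
    · rintro ⟨k, rfl⟩
      obtain ⟨v, rfl | rfl⟩ := hrange k
      · exact Or.inl ⟨v, (hfirst v).symm⟩
      · exact Or.inr ⟨v, (hlast v).symm⟩
    · rintro (⟨v, rfl⟩ | ⟨v, rfl⟩)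
      · exact ⟨_, hfirst v⟩
      · exact ⟨_, hlast v⟩
  · ext v
    change _ ↔ (Metric.closedBall (c v) r ∩ S.ray (z k)).Nonempty
    rw [mem_ray_inter_iff hr hdis, ← hfirst, ← hlast, hz.le_iff_le, hz.le_iff_le]
    rfl

/-- The bags of the angular sweep form a path decomposition: the polar angles of the points of the
disks form intervals, and the intervals of two intersecting disks intersect. -/
theorem isTreeDecomposition_of_rank {G : SimpleGraph (Fin n)} (hr : 0 < r)
    (hG : IsDiskRealization G r c)
    (hdis : ∀ v, Disjoint (Metric.closedBall (c v) r) (S.ray 0)) (hz : StrictMono z) (hm : 0 < m)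
    (hfirst : ∀ v, z (first v) = S.angleInf (c v) r)
    (hlast : ∀ v, z (last v) = S.angleSup (c v) r) :
    IsTreeDecomposition G (SimpleGraph.pathGraph m) (fun k => {v | first v ≤ k ∧ k ≤ last v}) := by
  have hle : ∀ v, first v ≤ last v := fun v => by
    rw [← hz.le_iff_le, hfirst, hlast]; exact angleInf_le_angleSup hr hdis v
  refine ⟨SimpleGraph.pathGraph_isTree hm, fun v => ⟨first v, le_rfl, hle v⟩,
    fun u v huv => ?_, fun v => ?_⟩
  · obtain ⟨p, hp⟩ := ((hG u v).mp huv).2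
    have h1 := (mem_ray_inter_iff hr hdis u (S.angle p)).mp ⟨p, hp.1, rfl⟩
    have h2 := (mem_ray_inter_iff hr hdis v (S.angle p)).mp ⟨p, hp.2, rfl⟩
    have h3 : first u ≤ last v := by
      rw [← hz.le_iff_le, hfirst, hlast]; exact h1.1.trans h2.2
    have h4 : first v ≤ last u := by
      rw [← hz.le_iff_le, hfirst, hlast]; exact h2.1.trans h1.2
    exact ⟨max (first u) (first v), ⟨le_max_left _ _, max_le (hle u) h4⟩,
      ⟨le_max_right _ _, max_le h3 (hle v)⟩⟩
  · exact SimpleGraph.connected_induce_pathGraph_Icc (a := first v) (b := last v) (hle v)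
      (last v).2

end Sweep

/-! ### Transport along a bijection of the vertices -/

theorem layeredTreeIndepNum_le {V : Type*} [Finite V] {n m k : ℕ} (e : V ≃ Fin n)
    {G : SimpleGraph V} {G' : SimpleGraph (Fin n)} (he : ∀ u v, G.Adj u v ↔ G'.Adj (e u) (e v))
    {T : SimpleGraph (Fin m)} {bag : Fin m → Set (Fin n)} {L : ℕ → Set (Fin n)}
    (hT : IsTreeDecomposition G' T bag) (hL : IsLayering G' L)
    (hw : WitnessLayered G' bag L k) : layeredTreeIndepNum G ≤ k := by
  have hT' : IsTreeDecomposition G T (fun t => e ⁻¹' bag t) :=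
    { isTree := hT.isTree
      vertex_mem := fun v => hT.vertex_mem (e v)
      edge_mem := fun u v huv => hT.edge_mem _ _ ((he u v).mp huv)
      connected := fun v => hT.connected (e v) }
  have hL' : IsLayering G (fun i => e ⁻¹' L i) :=
    { disjoint := fun i j hij => (hL.disjoint i j hij).preimage _
      iUnion_eq := by rw [← Set.preimage_iUnion, hL.iUnion_eq, Set.preimage_univ]
      eventually_empty := by
        obtain ⟨N, hN⟩ := hL.eventually_empty
        exact ⟨N, fun i hi => by rw [hN i hi, Set.preimage_empty]⟩
      adj := fun u v huv i j hu hv => hL.adj _ _ ((he u v).mp huv) i j hu hv }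
  have hw' : WitnessLayered G (fun t => e ⁻¹' bag t) (fun i => e ⁻¹' L i) k := by
    intro t i
    rw [SimpleGraph.indepNum_induce_le]
    intro I hI hind
    rw [← Finset.card_map e.toEmbedding]
    refine (SimpleGraph.indepNum_induce_le _ _ _).mp (hw t i) _ ?_ ?_
    · intro x hx
      simp only [Finset.coe_map, Set.mem_image] at hx
      obtain ⟨y, hy, rfl⟩ := hx
      exact hI hy
    · intro x hx y hy hxy
      simp only [Finset.coe_map, Set.mem_image] at hx hy
      obtain ⟨x, hx, rfl⟩ := hx
      obtain ⟨y, hy, rfl⟩ := hy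
      exact fun h => hind hx hy (fun h' => hxy (congrArg _ h')) ((he x y).mpr h)
  unfold layeredTreeIndepNum layeredIndepNum
  exact iInf_le_of_le m <| iInf_le_of_le T <| iInf_le_of_le _ <| iInf_le_of_le hT' <|
    iInf_le_of_le _ <| iInf_le_of_le k <| iInf_le_of_le ⟨hL', hw'⟩ le_rfl

theorem layeredTreeIndepNum_of_isEmpty {V : Type*} [IsEmpty V] (G : SimpleGraph V) (k : ℕ) :
    layeredTreeIndepNum G ≤ k := by
  have e : V ≃ Fin 0 := Equiv.equivOfIsEmpty _ _
  refine layeredTreeIndepNum_le (G' := ⊥) (T := SimpleGraph.pathGraph 1) (bag := fun _ => ∅)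
    (L := fun _ => ∅) e (fun u => isEmptyElim u) ?_ ?_ ?_
  · exact ⟨SimpleGraph.pathGraph_isTree one_pos, fun v => v.elim0, fun v => v.elim0,
      fun v => v.elim0⟩
  · exact ⟨fun _ _ _ => Set.disjoint_empty _, Set.eq_univ_of_forall fun v => v.elim0,
      ⟨0, fun _ _ => rfl⟩, fun v => v.elim0⟩
  · intro t i
    rw [SimpleGraph.indepNum_induce_le]
    intro I _ _
    have : I = ∅ := Finset.eq_empty_of_isEmpty I
    simp [this]

/-! ### A program logic with step bounds -/

namespace RealRAM

@[simp] theorem State.writeNat_nat (s : State) (a i x a' i' : ℕ) :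
    (s.writeNat a i x).nat a' i' = if a' = a ∧ i' = i then x else s.nat a' i' := by
  unfold State.writeNat
  by_cases h : a' = a
  · subst h
    simp [Function.update_apply]
  · simp [h]

@[simp] theorem State.writeNat_real (s : State) (a i x : ℕ) : (s.writeNat a i x).real = s.real :=
  rfl

@[simp] theorem State.writeReal_nat (s : State) (a i : ℕ) (x : ℝ) :
    (s.writeReal a i x).nat = s.nat := rfl

@[simp] theorem State.writeReal_real (s : State) (a i : ℕ) (x : ℝ) (a' i' : ℕ) :
    (s.writeReal a i x).real a' i' = if a' = a ∧ i' = i then x else s.real a' i' := by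
  unfold State.writeReal
  by_cases h : a' = a
  · subst h
    simp [Function.update_apply]
  · simp [h]

/-- The natural arrays that a program writes to. -/
def Prog.natWrites : Prog → List ℕ
  | .setN a _ _ => [a]
  | .setR _ _ _ => []
  | .setCeil a _ _ => [a]
  | .seq p q => p.natWrites ++ q.natWrites
  | .cond _ p q => p.natWrites ++ q.natWrites
  | .loop _ p => p.natWrites

/-- The real arrays that a program writes to. -/
def Prog.realWrites : Prog → List ℕ
  | .setN _ _ _ => []
  | .setR a _ _ => [a]
  | .setCeil _ _ _ => []
  | .seq p q => p.realWrites ++ q.realWrites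
  | .cond _ p q => p.realWrites ++ q.realWrites
  | .loop _ p => p.realWrites

/-- The two memories agree on all arrays that `p` does not write to. -/
structure Frame (p : Prog) (s s' : State) : Prop where
  nat : ∀ a, a ∉ p.natWrites → s'.nat a = s.nat a
  real : ∀ a, a ∉ p.realWrites → s'.real a = s.real a

theorem Frame.refl (p : Prog) (s : State) : Frame p s s := ⟨fun _ _ => rfl, fun _ _ => rfl⟩

theorem Frame.trans {p : Prog} {s s' s'' : State} (h : Frame p s s') (h' : Frame p s' s'') :
    Frame p s s'' :=
  ⟨fun a ha => (h'.nat a ha).trans (h.nat a ha), fun a ha => (h'.real a ha).trans (h.real a ha)⟩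

theorem Frame.mono {p q : Prog} {s s' : State} (h : Frame p s s')
    (h1 : ∀ a ∈ p.natWrites, a ∈ q.natWrites) (h2 : ∀ a ∈ p.realWrites, a ∈ q.realWrites) :
    Frame q s s' :=
  ⟨fun a ha => h.nat a (fun h' => ha (h1 a h')), fun a ha => h.real a (fun h' => ha (h2 a h'))⟩

/-- A program leaves unchanged all arrays that do not occur as targets in its code. -/
theorem Exec.frame {p : Prog} {s s' : State} {t : ℕ} (h : Exec p s t s') : Frame p s s' := by
  induction h with
  | setN a i x s =>
    refine ⟨fun a' ha => ?_, fun _ _ => rfl⟩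
    simp only [Prog.natWrites, List.mem_singleton] at ha
    exact Function.update_of_ne ha _ _
  | setR a i x s =>
    refine ⟨fun _ _ => rfl, fun a' ha => ?_⟩
    simp only [Prog.realWrites, List.mem_singleton] at ha
    exact Function.update_of_ne ha _ _
  | setCeil a i x s =>
    refine ⟨fun a' ha => ?_, fun _ _ => rfl⟩
    simp only [Prog.natWrites, List.mem_singleton] at ha
    exact Function.update_of_ne ha _ _
  | seq h h' ih ih' =>
    refine (ih.mono ?_ ?_).trans (ih'.mono ?_ ?_) <;>
      simp +contextual [Prog.natWrites, Prog.realWrites]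
  | cond_true hb h ih =>
    refine ih.mono ?_ ?_ <;> simp +contextual [Prog.natWrites, Prog.realWrites]
  | cond_false hb h ih =>
    refine ih.mono ?_ ?_ <;> simp +contextual [Prog.natWrites, Prog.realWrites]
  | loop_done hb => exact Frame.refl _ _
  | loop_step hb h h' ih ih' => exact Frame.trans (ih.mono (fun _ h => h) (fun _ h => h)) ih'

/-- Started in memory `s`, the program `p` halts after at most `K` steps in a memory that
satisfies `Q`. -/
def Runs (p : Prog) (s : State) (K : ℕ) (Q : State → Prop) : Prop :=
  ∃ t s', Exec p s t s' ∧ t ≤ K ∧ Q s'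

theorem Runs.mono {p : Prog} {s : State} {K K' : ℕ} {Q Q' : State → Prop} (h : Runs p s K Q)
    (hK : K ≤ K') (hQ : ∀ s', Frame p s s' → Q s' → Q' s') : Runs p s K' Q' := by
  obtain ⟨t, s', h1, h2, h3⟩ := h
  exact ⟨t, s', h1, h2.trans hK, hQ s' h1.frame h3⟩

theorem Runs.seq {p q : Prog} {s : State} {K K' : ℕ} {Q Q' : State → Prop} (h : Runs p s K Q)
    (h' : ∀ s', Frame p s s' → Q s' → Runs q s' K' Q') : Runs (.seq p q) s (K + K') Q' := by
  obtain ⟨t, s', h1, h2, h3⟩ := h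
  obtain ⟨t', s'', h4, h5, h6⟩ := h' s' h1.frame h3
  exact ⟨t + t', s'', .seq h1 h4, by omega, h6⟩

/-- A loop with exactly `N` iterations: the invariant `I k` holds after `k` of them. -/
theorem Runs.loop {b : Test} {p : Prog} {s : State} {K : ℕ} (N : ℕ) (I : ℕ → State → Prop)
    (h0 : I 0 s)
    (hstep : ∀ k s', k < N → Frame p s s' → I k s' → b.holds s' ∧ Runs p s' K (I (k + 1)))
    (hend : ∀ s', Frame p s s' → I N s' → ¬ b.holds s') :
    Runs (.loop b p) s (N * (b.cost + K) + b.cost) (I N) := by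
  suffices h : ∀ d k s', k + d = N → Frame p s s' → I k s' →
      Runs (.loop b p) s' (d * (b.cost + K) + b.cost) (I N) from
    h N 0 s (Nat.zero_add N) (Frame.refl p s) h0
  intro d
  induction d with
  | zero =>
    intro k s' hk hf hI
    obtain rfl : k = N := by omega
    exact ⟨_, s', .loop_done (hend s' hf hI), by simp, hI⟩
  | succ d ih =>
    intro k s' hk hf hI
    obtain ⟨hb, t, s'', h1, h2, h3⟩ := hstep k s' (by omega) hf hI
    obtain ⟨t', s''', h4, h5, h6⟩ := ih (k + 1) s'' (by omega) (hf.trans h1.frame) h3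
    exact ⟨_, s''', .loop_step hb h1 h4, by rw [Nat.succ_mul]; omega, h6⟩

/-- Programs without loops. -/
def Prog.loopFree : Prog → Bool
  | .setN _ _ _ => true
  | .setR _ _ _ => true
  | .setCeil _ _ _ => true
  | .seq p q => p.loopFree && q.loopFree
  | .cond _ p q => p.loopFree && q.loopFree
  | .loop _ _ => false

/-- A bound on the number of steps of a program without loops. -/
def Prog.maxCost : Prog → ℕ
  | .setN _ i x => i.cost + x.cost + 1
  | .setR _ i x => i.cost + x.cost + 1
  | .setCeil _ i x => i.cost + x.cost + 1
  | .seq p q => p.maxCost + q.maxCost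
  | .cond b p q => b.cost + max p.maxCost q.maxCost
  | .loop _ _ => 0

open Classical in
/-- The memory in which a program without loops halts. -/
noncomputable def Prog.run : Prog → State → State
  | .setN a i x, s => s.writeNat a (i.eval s) (x.eval s)
  | .setR a i x, s => s.writeReal a (i.eval s) (x.eval s)
  | .setCeil a i x, s => s.writeNat a (i.eval s) ⌈x.eval s⌉₊
  | .seq p q, s => q.run (p.run s)
  | .cond b p q, s => if b.holds s then p.run s else q.run s
  | .loop _ _, s => s

theorem Runs.of_loopFree {p : Prog} (hp : p.loopFree = true) {s : State} {K : ℕ}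
    {Q : State → Prop} (hK : p.maxCost ≤ K) (hQ : Q (p.run s)) : Runs p s K Q := by
  suffices h : ∃ t, Exec p s t (p.run s) ∧ t ≤ p.maxCost by
    obtain ⟨t, h1, h2⟩ := h
    exact ⟨t, _, h1, h2.trans hK, hQ⟩
  clear hK hQ
  induction p generalizing s with
  | setN a i x => exact ⟨_, .setN a i x s, le_rfl⟩
  | setR a i x => exact ⟨_, .setR a i x s, le_rfl⟩
  | setCeil a i x => exact ⟨_, .setCeil a i x s, le_rfl⟩
  | seq p q ihp ihq =>
    simp only [Prog.loopFree, Bool.and_eq_true] at hp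
    obtain ⟨t, h1, h2⟩ := ihp hp.1 (s := s)
    obtain ⟨t', h3, h4⟩ := ihq hp.2 (s := p.run s)
    exact ⟨_, .seq h1 h3, Nat.add_le_add h2 h4⟩
  | cond b p q ihp ihq =>
    simp only [Prog.loopFree, Bool.and_eq_true] at hp
    simp only [Prog.run, Prog.maxCost]
    split_ifs with hb
    · obtain ⟨t, h1, h2⟩ := ihp hp.1 (s := s)
      exact ⟨_, .cond_true hb h1, by omega⟩
    · obtain ⟨t, h1, h2⟩ := ihq hp.2 (s := s)
      exact ⟨_, .cond_false hb h1, by omega⟩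
  | loop b p _ => simp [Prog.loopFree] at hp

/-- The scalar variable kept at position `0` of a natural array. -/
abbrev nvar (a : ℕ) : NExp := .get a (.lit 0)

/-- The scalar variable kept at position `0` of a real array. -/
abbrev rvar (a : ℕ) : RExp := .get a (.lit 0)

/-- Assignment to a scalar variable. -/
abbrev assignN (a : ℕ) (x : NExp) : Prog := .setN a (.lit 0) x

/-- Assignment to a scalar variable. -/
abbrev assignR (a : ℕ) (x : RExp) : Prog := .setR a (.lit 0) x

/-- Execute `body` for all values of the variable in the natural array `11` from `lo` up to, but not
including, `hi`. -/
def forLoop (lo hi : NExp) (body : Prog) : Prog :=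
  .seq (assignN 11 lo)
    (.loop (.ltN (nvar 11) hi) (.seq body (assignN 11 (.plus (nvar 11) (.lit 1)))))

/-- The rule for a counting loop whose body has no loops. The invariant `I k` may refer to all
arrays but the one of the counter; the bound `hi` must not change. -/
theorem Runs.forLoop {lo hi : NExp} {body : Prog} {s : State} {N : ℕ} (I : ℕ → State → Prop)
    (hbody : body.loopFree = true) (h11 : 11 ∉ body.natWrites) (hN : lo.eval s ≤ N)
    (h0 : I (lo.eval s) (s.writeNat 11 0 (lo.eval s)))
    (hhi : ∀ k s', Frame (.seq body (assignN 11 (.lit 0))) s s' → I k s' → hi.eval s' = N)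
    (hstep : ∀ k s', k < N → Frame (.seq body (assignN 11 (.lit 0))) s s' → s'.nat 11 0 = k →
      I k s' → I (k + 1) ((body.run s').writeNat 11 0 (k + 1))) :
    Runs (RealRAM.forLoop lo hi body) s
      ((N + 1) * (hi.cost + body.maxCost + 10) + lo.cost) (fun s' => I N s') := by
  have hfr : ∀ {s'}, Frame (.seq body (assignN 11 (.plus (nvar 11) (.lit 1))))
      (s.writeNat 11 0 (lo.eval s)) s' → Frame (.seq body (assignN 11 (.lit 0))) s s' := by
    intro s' h
    have h1 : Frame (assignN 11 lo) s (s.writeNat 11 0 (lo.eval s)) :=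
      (Exec.setN 11 (.lit 0) lo s).frame
    refine (h1.mono ?_ ?_).trans (h.mono ?_ ?_) <;>
      simp [Prog.natWrites, Prog.realWrites]
  have hloop := Runs.loop (b := .ltN (nvar 11) hi)
    (p := .seq body (assignN 11 (.plus (nvar 11) (.lit 1)))) (s := s.writeNat 11 0 (lo.eval s))
    (K := body.maxCost + 6) (N - lo.eval s)
    (fun k s' => s'.nat 11 0 = lo.eval s + k ∧ I (lo.eval s + k) s') (by simpa using h0)
    (by
      rintro k s' hk hf ⟨h1, h2⟩
      have h3 := hhi _ s' (hfr hf) h2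
      refine ⟨by simp only [Test.holds, NExp.eval, h1, h3]; omega, ?_⟩
      apply Runs.of_loopFree (by simp [Prog.loopFree, hbody])
      · simp [Prog.maxCost, NExp.cost]
      · have h4 : (body.run s').nat 11 = s'.nat 11 := by
          obtain ⟨t, s'', h5, -, h6⟩ :=
            Runs.of_loopFree hbody le_rfl (s := s') (Q := fun x => x = body.run s') rfl
          rw [← h6]
          exact h5.frame.nat 11 h11
        have h5 := hstep _ s' (by omega) (hfr hf) h1 h2
        simp only [Prog.run, NExp.eval, h4, h1]
        refine ⟨by simp; omega, ?_⟩
        rwa [← add_assoc])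
    (by
      rintro s' hf ⟨h1, h2⟩
      have h3 := hhi _ s' (hfr hf) h2
      simp only [Test.holds, NExp.eval, h1, h3]
      omega)
  have hinit : Runs (assignN 11 lo) s (lo.cost + 2)
      (fun s' => s' = s.writeNat 11 0 (lo.eval s)) :=
    Runs.of_loopFree rfl (by simp [Prog.maxCost, NExp.cost]; omega) rfl
  refine (hinit.seq (fun s' _ hs' => hs' ▸ hloop)).mono ?_ ?_
  · simp only [Test.cost, NExp.cost]
    have h1 : N - lo.eval s ≤ N := Nat.sub_le _ _
    have h2 := Nat.mul_le_mul_right (1 + 1 + hi.cost + 1 + (body.maxCost + 6)) h1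
    nlinarith
  · rintro s' - ⟨-, h⟩
    rwa [Nat.add_sub_cancel' hN] at h

end RealRAM

/-! ### Merging sorted blocks -/

/-- Progress of merging the adjacent blocks `[base, base + w)` and `[base + w, base + 2 w)` of `B`
into `A`, after `x` entries of the first and `y` entries of the second block have been moved. -/
structure Merged (key : ℕ → ℝ) (B A : ℕ → ℕ) (base w x y : ℕ) : Prop where
  sorted : ∀ p q, base ≤ p → p ≤ q → q < base + x + y → key (A p) ≤ key (A q)
  below : ∀ p q, base ≤ p → p < base + x + y →
    (base + x ≤ q ∧ q < base + w ∨ base + w + y ≤ q ∧ q < base + w + w) → key (A p) ≤ key (B q)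
  surj : ∀ q, (base ≤ q ∧ q < base + x ∨ base + w ≤ q ∧ q < base + w + y) →
    ∃ p, base ≤ p ∧ p < base + x + y ∧ A p = B q
  mem : ∀ p, base ≤ p → p < base + x + y → ∃ q, base ≤ q ∧ q < base + w + w ∧ A p = B q

/-- The entries of `A` in the interval `[lo, hi)` are sorted by their keys. -/
def SortedOn (key : ℕ → ℝ) (A : ℕ → ℕ) (lo hi : ℕ) : Prop :=
  ∀ p q, lo ≤ p → p ≤ q → q < hi → key (A p) ≤ key (A q)

theorem Merged.init (key : ℕ → ℝ) (B A : ℕ → ℕ) (base w : ℕ) : Merged key B A base w 0 0 :=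
  ⟨by omega, by omega, by omega, by omega⟩

/-- Moving the next entry of the first block is sound if the second block is exhausted or its next
entry is not smaller. -/
theorem Merged.step_left {key : ℕ → ℝ} {B A A' : ℕ → ℕ} {base w x y : ℕ}
    (h : Merged key B A base w x y) (h1 : SortedOn key B base (base + w))
    (h2 : SortedOn key B (base + w) (base + w + w)) (hx : x < w)
    (hle : y < w → key (B (base + x)) ≤ key (B (base + w + y)))
    (hA : ∀ p, A' p = if p = base + x + y then B (base + x) else A p) :
    Merged key B A' base w (x + 1) y := by
  have hlast : A' (base + x + y) = B (base + x) := by rw [hA, if_pos rfl]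
  have hold : ∀ p, p < base + x + y → A' p = A p := fun p hp => by
    rw [hA, if_neg (by omega)]
  refine ⟨fun p q hp hpq hq => ?_, fun p q hp hp' hq => ?_, fun q hq => ?_, fun p hp hp' => ?_⟩
  · rcases Nat.lt_or_ge q (base + x + y) with hq' | hq'
    · rw [hold p (by omega), hold q hq']
      exact h.sorted p q hp hpq hq'
    · obtain rfl : q = base + x + y := by omega
      rw [hlast]
      rcases Nat.lt_or_ge p (base + x + y) with hp' | hp'
      · rw [hold p hp']
        exact h.below p _ hp hp' (Or.inl ⟨le_rfl, by omega⟩)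
      · obtain rfl : p = base + x + y := by omega
        rw [hlast]
  · rcases Nat.lt_or_ge p (base + x + y) with hp'' | hp''
    · rw [hold p hp'']
      exact h.below p q hp hp'' (by omega)
    · obtain rfl : p = base + x + y := by omega
      rw [hlast]
      rcases hq with hq | hq
      · exact h1 _ _ (by omega) (by omega) hq.2
      · exact (hle (by omega)).trans (h2 _ _ (by omega) hq.1 hq.2)
  · by_cases hqx : q = base + x
    · exact ⟨base + x + y, by omega, by omega, by rw [hlast, hqx]⟩
    · obtain ⟨p, hp1, hp2, hp3⟩ := h.surj q (by omega)
      exact ⟨p, hp1, by omega, by rw [hold p hp2, hp3]⟩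
  · rcases Nat.lt_or_ge p (base + x + y) with hp'' | hp''
    · rw [hold p hp'']
      exact h.mem p hp hp''
    · obtain rfl : p = base + x + y := by omega
      exact ⟨base + x, by omega, by omega, hlast⟩

theorem Merged.step_right {key : ℕ → ℝ} {B A A' : ℕ → ℕ} {base w x y : ℕ}
    (h : Merged key B A base w x y) (h1 : SortedOn key B base (base + w))
    (h2 : SortedOn key B (base + w) (base + w + w)) (hy : y < w)
    (hle : x < w → key (B (base + w + y)) ≤ key (B (base + x)))
    (hA : ∀ p, A' p = if p = base + x + y then B (base + w + y) else A p) :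
    Merged key B A' base w x (y + 1) := by
  have hlast : A' (base + x + y) = B (base + w + y) := by rw [hA, if_pos rfl]
  have hold : ∀ p, p < base + x + y → A' p = A p := fun p hp => by
    rw [hA, if_neg (by omega)]
  refine ⟨fun p q hp hpq hq => ?_, fun p q hp hp' hq => ?_, fun q hq => ?_, fun p hp hp' => ?_⟩
  · rcases Nat.lt_or_ge q (base + x + y) with hq' | hq'
    · rw [hold p (by omega), hold q hq']
      exact h.sorted p q hp hpq hq'
    · obtain rfl : q = base + x + y := by omega
      rw [hlast]
      rcases Nat.lt_or_ge p (base + x + y) with hp' | hp'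
      · rw [hold p hp']
        exact h.below p _ hp hp' (Or.inr ⟨le_rfl, by omega⟩)
      · obtain rfl : p = base + x + y := by omega
        rw [hlast]
  · rcases Nat.lt_or_ge p (base + x + y) with hp'' | hp''
    · rw [hold p hp'']
      exact h.below p q hp hp'' (by omega)
    · obtain rfl : p = base + x + y := by omega
      rw [hlast]
      rcases hq with hq | hq
      · exact (hle (by omega)).trans (h1 _ _ (by omega) hq.1 hq.2)
      · exact h2 _ _ (by omega) (by omega) hq.2
  · by_cases hqx : q = base + w + y
    · exact ⟨base + x + y, by omega, by omega, by rw [hlast, hqx]⟩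
    · obtain ⟨p, hp1, hp2, hp3⟩ := h.surj q (by omega)
      exact ⟨p, hp1, by omega, by rw [hold p hp2, hp3]⟩
  · rcases Nat.lt_or_ge p (base + x + y) with hp'' | hp''
    · rw [hold p hp'']
      exact h.mem p hp hp''
    · obtain rfl : p = base + x + y := by omega
      exact ⟨base + w + y, by omega, by omega, hlast⟩

theorem Merged.congr {key : ℕ → ℝ} {B A A' : ℕ → ℕ} {base w x y : ℕ}
    (h : Merged key B A base w x y) (hA : ∀ p, base ≤ p → p < base + x + y → A' p = A p) :
    Merged key B A' base w x y := by
  refine ⟨fun p q hp hpq hq => ?_, fun p q hp hp' hq => ?_, fun q hq => ?_, fun p hp hp' => ?_⟩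
  · rw [hA p hp (by omega), hA q (by omega) hq]; exact h.sorted p q hp hpq hq
  · rw [hA p hp hp']; exact h.below p q hp hp' hq
  · obtain ⟨p, hp1, hp2, hp3⟩ := h.surj q hq
    exact ⟨p, hp1, hp2, by rw [hA p hp1 hp2, hp3]⟩
  · rw [hA p hp hp']; exact h.mem p hp hp'

/-! ### Merge sort on the real RAM

The keys are in the real array `3`; the natural array `4` holds the list of indices that is sorted,
and the array `5` a copy of it. The array `6` holds the length `2 ^ L` of the list, `7` the width of
the blocks, `8` the start of the current pair of blocks, and `9`, `10`, `11` the reading positions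
in the two blocks and the writing position. -/

namespace RealRAM

/-- One step of merging: move the smaller one of the next entries of the two blocks. -/
def mergeStep : Prog :=
  .seq
    (.cond (.both (.ltN (nvar 9) (.plus (nvar 8) (nvar 7)))
        (.neg (.both (.ltN (nvar 10) (.plus (.plus (nvar 8) (nvar 7)) (nvar 7)))
          (.ltR (.get 3 (.get 5 (nvar 10))) (.get 3 (.get 5 (nvar 9)))))))
      (.seq (.setN 4 (nvar 11) (.get 5 (nvar 9))) (assignN 9 (.plus (nvar 9) (.lit 1))))
      (.seq (.setN 4 (nvar 11) (.get 5 (nvar 10))) (assignN 10 (.plus (nvar 10) (.lit 1)))))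
    (assignN 11 (.plus (nvar 11) (.lit 1)))

/-- Merge the pair of blocks that starts at the position in the array `8`, and move on. -/
def mergeBlocks : Prog :=
  .seq (.seq (assignN 9 (nvar 8)) (.seq (assignN 10 (.plus (nvar 8) (nvar 7)))
      (assignN 11 (nvar 8))))
    (.seq (.loop (.ltN (nvar 11) (.plus (.plus (nvar 8) (nvar 7)) (nvar 7))) mergeStep)
      (assignN 8 (.plus (.plus (nvar 8) (nvar 7)) (nvar 7))))

/-- Copy the list, merge its blocks in pairs, and double the width of the blocks. -/
def mergePass : Prog :=
  .seq (forLoop (.lit 0) (nvar 6) (.setN 5 (nvar 11) (.get 4 (nvar 11))))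
    (.seq (assignN 8 (.lit 0))
      (.seq (.loop (.ltN (nvar 8) (nvar 6)) mergeBlocks)
        (assignN 7 (.plus (nvar 7) (nvar 7)))))

/-- Sort the list. -/
def mergeSort : Prog :=
  .seq (assignN 7 (.lit 1)) (.loop (.ltN (nvar 7) (nvar 6)) mergePass)

theorem runs_mergeBlocks {s : State} {base w : ℕ} (hbase : s.nat 8 0 = base) (hw : s.nat 7 0 = w)
    (h1 : SortedOn (s.real 3) (s.nat 5) base (base + w))
    (h2 : SortedOn (s.real 3) (s.nat 5) (base + w) (base + w + w)) :
    Runs mergeBlocks s (200 * w + 100) (fun s' => s'.nat 8 0 = base + w + w ∧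
      Merged (s.real 3) (s.nat 5) (s'.nat 4) base w w w ∧
      ∀ p, p < base → s'.nat 4 p = s.nat 4 p) := by
  have hinit : Runs (.seq (assignN 9 (nvar 8)) (.seq (assignN 10 (.plus (nvar 8) (nvar 7)))
      (assignN 11 (nvar 8)))) s 20 (fun s' => s'.nat 9 0 = base ∧ s'.nat 10 0 = base + w ∧
        s'.nat 11 0 = base) := by
    apply Runs.of_loopFree rfl (by decide)
    simp [Prog.run, NExp.eval, hbase, hw]
  refine (hinit.seq (K' := 200 * w + 80) (fun s0 hf0 h0 => ?_)).mono (by omega)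
    (fun _ _ h => h)
  obtain ⟨hi0, hj0, hk0⟩ := h0
  have e8 : s0.nat 8 = s.nat 8 := hf0.nat 8 (by decide)
  have e7 : s0.nat 7 = s.nat 7 := hf0.nat 7 (by decide)
  have e5 : s0.nat 5 = s.nat 5 := hf0.nat 5 (by decide)
  have e4 : s0.nat 4 = s.nat 4 := hf0.nat 4 (by decide)
  have e3 : s0.real 3 = s.real 3 := hf0.real 3 (by decide)
  have hloop := Runs.loop (b := .ltN (nvar 11) (.plus (.plus (nvar 8) (nvar 7)) (nvar 7)))
    (p := mergeStep) (s := s0) (K := 60) (2 * w)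
    (fun d s' => ∃ x y, x ≤ w ∧ y ≤ w ∧ x + y = d ∧ s'.nat 9 0 = base + x ∧
      s'.nat 10 0 = base + w + y ∧ s'.nat 11 0 = base + d ∧
      Merged (s.real 3) (s.nat 5) (s'.nat 4) base w x y ∧
      ∀ p, p < base → s'.nat 4 p = s.nat 4 p)
    ⟨0, 0, Nat.zero_le _, Nat.zero_le _, rfl, hi0, hj0, hk0, Merged.init _ _ _ _ _,
      fun p _ => by rw [e4]⟩
    (by
      rintro d s' hd hf ⟨x, y, hx, hy, hxy, hi, hj, hk, hM, hlow⟩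
      have f8 : s'.nat 8 0 = base := by rw [hf.nat 8 (by decide), e8, hbase]
      have f7 : s'.nat 7 0 = w := by rw [hf.nat 7 (by decide), e7, hw]
      have f5 : s'.nat 5 = s.nat 5 := by rw [hf.nat 5 (by decide), e5]
      have f3 : s'.real 3 = s.real 3 := by rw [hf.real 3 (by decide), e3]
      refine ⟨by simp only [Test.holds, NExp.eval, f8, f7, hk]; omega, ?_⟩
      apply Runs.of_loopFree rfl (by decide)
      have hk' : base + d = base + x + y := by omega
      -- the test of the program; out-of-block entries may be read, but do not affect its outcome
      by_cases hc : x < w ∧ ¬ (y < w ∧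
        s.real 3 (s.nat 5 (base + w + y)) < s.real 3 (s.nat 5 (base + x)))
      · refine ⟨x + 1, y, hc.1, hy, by omega, ?_⟩
        have hM' := hM.step_left (A' := fun p => if p = base + x + y then s.nat 5 (base + x)
          else s'.nat 4 p) h1 h2 hc.1 (fun h => not_lt.mp fun h' => hc.2 ⟨h, h'⟩) (fun _ => rfl)
        simp only [mergeStep, Prog.run, Test.holds, NExp.eval, RExp.eval, f8, f7, hi, hj, f5, f3,
          add_lt_add_iff_left, if_pos hc, hk, hk']
        simp only [State.writeNat_nat]
        refine ⟨by simp [hi, add_assoc], by simp [hj], by simp; omega, ?_, ?_⟩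
        · refine hM'.congr fun p _ _ => by simp
        · intro p hp
          rw [← hlow p hp]
          simp; omega
      · have hyw : y < w := by
          by_contra h
          exact hc ⟨by omega, fun h' => h h'.1⟩
        refine ⟨x, y + 1, hx, hyw, by omega, ?_⟩
        have hM' := hM.step_right (A' := fun p => if p = base + x + y then s.nat 5 (base + w + y)
          else s'.nat 4 p) h1 h2 hyw (fun h => by
            by_contra h'
            exact hc ⟨h, fun h'' => h' h''.2.le⟩) (fun _ => rfl)
        simp only [mergeStep, Prog.run, Test.holds, NExp.eval, RExp.eval, f8, f7, hi, hj, f5, f3,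
          add_lt_add_iff_left, if_neg hc, hk, hk']
        simp only [State.writeNat_nat]
        refine ⟨by simp [hi], by simp [hj, add_assoc], by simp; omega, ?_, ?_⟩
        · refine hM'.congr fun p _ _ => by simp
        · intro p hp
          rw [← hlow p hp]
          simp; omega)
    (by
      rintro s' hf ⟨x, y, hx, hy, hxy, hi, hj, hk, -⟩
      have f8 : s'.nat 8 0 = base := by rw [hf.nat 8 (by decide), e8, hbase]
      have f7 : s'.nat 7 0 = w := by rw [hf.nat 7 (by decide), e7, hw]
      simp only [Test.holds, NExp.eval, f8, f7, hk]
      omega)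
  refine (hloop.seq (K' := 20) (fun s1 hf1 h1' => ?_)).mono ?_ (fun _ _ h => h)
    (Q' := fun s' => s'.nat 8 0 = base + w + w ∧
      Merged (s.real 3) (s.nat 5) (s'.nat 4) base w w w ∧
      ∀ p, p < base → s'.nat 4 p = s.nat 4 p)
  · obtain ⟨x, y, hx, hy, hxy, -, -, -, hM, hlow⟩ := h1'
    obtain ⟨rfl, rfl⟩ : x = w ∧ y = w := by omega
    have f8 : s1.nat 8 0 = base := by rw [hf1.nat 8 (by decide), e8, hbase]
    have f7 : s1.nat 7 0 = y := by rw [hf1.nat 7 (by decide), e7, hw]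
    apply Runs.of_loopFree rfl (by decide)
    simp only [Prog.run, NExp.eval, f8, f7]
    refine ⟨by simp, hM.congr fun p _ _ => by simp, fun p hp => ?_⟩
    rw [← hlow p hp]
    simp
  · simp only [Test.cost, NExp.cost]
    omega

/-- The array `A` lists the numbers below `N`, and its blocks of width `w` are sorted. -/
structure BlockSorted (key : ℕ → ℝ) (A : ℕ → ℕ) (N w : ℕ) : Prop where
  sorted : ∀ q, (q + 1) * w ≤ N → SortedOn key A (q * w) (q * w + w)
  surj : ∀ x, x < N → ∃ p, p < N ∧ A p = x
  lt : ∀ p, p < N → A p < N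

theorem runs_mergePass {s : State} {M w : ℕ} (hN : s.nat 6 0 = M * (w + w)) (hw : s.nat 7 0 = w)
    (hw0 : 0 < w) (h : BlockSorted (s.real 3) (s.nat 4) (M * (w + w)) w) :
    Runs mergePass s (500 * (M * (w + w)) + 100) (fun s' => s'.nat 7 0 = w + w ∧
      BlockSorted (s.real 3) (s'.nat 4) (M * (w + w)) (w + w)) := by
  set N := M * (w + w) with hNdef
  have hcopy := Runs.forLoop (lo := .lit 0) (hi := nvar 6)
    (body := .setN 5 (nvar 11) (.get 4 (nvar 11))) (s := s) (N := N)
    (fun k s' => ∀ p, p < k → s'.nat 5 p = s.nat 4 p) rfl (by decide) (Nat.zero_le _)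
    (fun p hp => by simp [NExp.eval] at hp)
    (fun k s' hf _ => by simp only [NExp.eval]; rw [hf.nat 6 (by decide), hN])
    (by
      intro k s' hk hf h11 hI p hp
      have f4 : s'.nat 4 = s.nat 4 := hf.nat 4 (by decide)
      simp only [Prog.run, NExp.eval, h11, f4, State.writeNat_nat]
      rcases Nat.lt_succ_iff_lt_or_eq.mp hp with hp | rfl
      · simp [hp.ne, hI p hp]
      · simp)
  refine (hcopy.seq (K' := 450 * N + 50) (fun s0 hf0 hB => ?_)).mono ?_ (fun _ _ h => h)
  swap
  · simp only [NExp.cost, Prog.maxCost]; omega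
  have hset : Runs (assignN 8 (.lit 0)) s0 3 (fun s' => s' = s0.writeNat 8 0 0) :=
    Runs.of_loopFree rfl (by decide) rfl
  refine (hset.seq (K' := 450 * N + 40) (fun s1 hf1 hs1 => ?_)).mono (by omega)
    (fun _ _ h => h)
  have g6 : s1.nat 6 0 = N := by rw [hf1.nat 6 (by decide), hf0.nat 6 (by decide), hN]
  have g7 : s1.nat 7 0 = w := by rw [hf1.nat 7 (by decide), hf0.nat 7 (by decide), hw]
  have g5 : s1.nat 5 = s0.nat 5 := hf1.nat 5 (by decide)
  have g3 : s1.real 3 = s.real 3 := by rw [hf1.real 3 (by decide), hf0.real 3 (by decide)]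
  have hsortB : ∀ q, (q + 1) * w ≤ N → SortedOn (s.real 3) (s1.nat 5) (q * w) (q * w + w) := by
    intro q hq p p' hp hpp' hp'
    rw [Nat.succ_mul] at hq
    rw [g5, hB p (by omega), hB p' (by omega)]
    exact h.sorted q (by rwa [Nat.succ_mul]) p p' hp hpp' hp'
  have hloop := Runs.loop (b := .ltN (nvar 8) (nvar 6)) (p := mergeBlocks) (s := s1)
    (K := 200 * w + 100) M
    (fun q s' => s'.nat 8 0 = q * (w + w) ∧ ∀ q' < q,
      Merged (s.real 3) (s1.nat 5) (s'.nat 4) (q' * (w + w)) w w w)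
    ⟨by rw [hs1]; simp, by omega⟩
    (by
      rintro q s' hq hf ⟨h8, hM⟩
      have f6 : s'.nat 6 0 = N := by rw [hf.nat 6 (by decide), g6]
      have f7 : s'.nat 7 0 = w := by rw [hf.nat 7 (by decide), g7]
      have f5 : s'.nat 5 = s1.nat 5 := hf.nat 5 (by decide)
      have f3 : s'.real 3 = s.real 3 := by rw [hf.real 3 (by decide), g3]
      have hqN : (q + 1) * (w + w) ≤ N := Nat.mul_le_mul_right _ hq
      have hqN' := hqN
      rw [Nat.succ_mul] at hqN'
      refine ⟨by simp only [Test.holds, NExp.eval, h8, f6]; omega, ?_⟩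
      have e1 : q * (w + w) = 2 * q * w := by ring
      have e2 : q * (w + w) + w = (2 * q + 1) * w := by ring
      refine (runs_mergeBlocks h8 f7 ?_ ?_).mono le_rfl ?_
      · rw [f3, f5, e1]
        exact hsortB (2 * q) (by nlinarith)
      · rw [f3, f5, e2]
        exact hsortB (2 * q + 1) (by nlinarith)
      · rintro s'' - ⟨k1, k2, k3⟩
        rw [f3, f5] at k2
        refine ⟨by rw [k1]; ring, fun q' hq' => ?_⟩
        rcases Nat.lt_succ_iff_lt_or_eq.mp hq' with hq' | rfl
        · refine (hM q' hq').congr fun p _ hp => k3 p ?_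
          have := Nat.mul_le_mul_right (w + w) (Nat.succ_le_of_lt hq')
          rw [Nat.succ_mul] at this
          omega
        · exact k2)
    (by
      rintro s' hf ⟨h8, -⟩
      have f6 : s'.nat 6 0 = N := by rw [hf.nat 6 (by decide), g6]
      simp only [Test.holds, NExp.eval, h8, f6, hNdef]
      omega)
  refine (hloop.seq (K' := 20) (fun s2 hf2 h2 => ?_)).mono ?_ (fun _ _ h => h)
    (Q' := fun s' => s'.nat 7 0 = w + w ∧ BlockSorted (s.real 3) (s'.nat 4) N (w + w))
  · obtain ⟨-, hM⟩ := h2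
    have f7 : s2.nat 7 0 = w := by rw [hf2.nat 7 (by decide), g7]
    have hww : 0 < w + w := by omega
    have hblock : ∀ p, p < N → p / (w + w) < M ∧ p / (w + w) * (w + w) ≤ p ∧
        p < p / (w + w) * (w + w) + w + w := by
      intro p hp
      refine ⟨(Nat.div_lt_iff_lt_mul hww).mpr hp, Nat.div_mul_le_self _ _, ?_⟩
      have := Nat.lt_div_mul_add (a := p) hww
      omega
    have hMN : ∀ q < M, q * (w + w) + w + w ≤ N := by
      intro q hq
      have := Nat.mul_le_mul_right (w + w) (Nat.succ_le_of_lt hq)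
      rw [Nat.succ_mul] at this
      omega
    have hbs : BlockSorted (s.real 3) (s2.nat 4) N (w + w) := by
      refine ⟨fun q hq p p' hp hpp' hp' => ?_, fun x hx => ?_, fun p hp => ?_⟩
      · have hqM : q < M := Nat.lt_of_succ_le (Nat.le_of_mul_le_mul_right hq hww)
        exact (hM q hqM).sorted p p' hp hpp' (by omega)
      · obtain ⟨p, hp, hpx⟩ := h.surj x hx
        obtain ⟨b1, b2, b3⟩ := hblock p hp
        obtain ⟨p', c1, c2, c3⟩ := (hM _ b1).surj p (by omega)
        refine ⟨p', ?_, ?_⟩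
        · have := hMN _ b1
          omega
        · rw [c3, g5, hB p hp, hpx]
      · obtain ⟨b1, b2, b3⟩ := hblock p hp
        obtain ⟨p', c1, c2, c3⟩ := (hM _ b1).mem p b2 b3
        have hp' : p' < N := by
          have := hMN _ b1
          omega
        rw [c3, g5, hB p' hp']
        exact h.lt p' hp'
    apply Runs.of_loopFree rfl (by decide)
    simp only [Prog.run, NExp.eval, f7]
    refine ⟨by simp, ?_⟩
    have : (s2.writeNat 7 0 (w + w)).nat 4 = s2.nat 4 := by ext p; simp
    rw [this]
    exact hbs
  · simp only [Test.cost, NExp.cost]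
    have : M ≤ M * w := Nat.le_mul_of_pos_right M hw0
    rw [hNdef]
    nlinarith

theorem runs_mergeSort {s : State} {L : ℕ} (hN : s.nat 6 0 = 2 ^ L)
    (hA : ∀ p, p < 2 ^ L → s.nat 4 p = p) :
    Runs mergeSort s (L * (500 * 2 ^ L + 120) + 20) (fun s' =>
      BlockSorted (s.real 3) (s'.nat 4) (2 ^ L) (2 ^ L)) := by
  have hset : Runs (assignN 7 (.lit 1)) s 3 (fun s' => s' = s.writeNat 7 0 1) :=
    Runs.of_loopFree rfl (by decide) rfl
  refine (hset.seq (K' := L * (500 * 2 ^ L + 120) + 10) (fun s0 hf0 hs0 => ?_)).mono (by omega)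
    (fun _ _ h => h)
  have g6 : s0.nat 6 0 = 2 ^ L := by rw [hf0.nat 6 (by decide), hN]
  have g4 : s0.nat 4 = s.nat 4 := hf0.nat 4 (by decide)
  have g3 : s0.real 3 = s.real 3 := hf0.real 3 (by decide)
  have hloop := Runs.loop (b := .ltN (nvar 7) (nvar 6)) (p := mergePass) (s := s0)
    (K := 500 * 2 ^ L + 100) L
    (fun l s' => s'.nat 7 0 = 2 ^ l ∧ BlockSorted (s.real 3) (s'.nat 4) (2 ^ L) (2 ^ l))
    ⟨by rw [hs0]; simp, by
      refine ⟨fun q hq p p' hp hpp' hp' => ?_, fun x hx => ⟨x, hx, ?_⟩, fun p hp => ?_⟩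
      · obtain rfl : p = p' := by simp at hp hp'; omega
        exact le_rfl
      · rw [g4, hA x hx]
      · rw [g4, hA p hp]; exact hp⟩
    (by
      rintro l s' hl hf ⟨h7, hS⟩
      have f6 : s'.nat 6 0 = 2 ^ L := by rw [hf.nat 6 (by decide), g6]
      have f3 : s'.real 3 = s.real 3 := by rw [hf.real 3 (by decide), g3]
      have hlL : (2 : ℕ) ^ L = 2 ^ (L - (l + 1)) * (2 ^ l + 2 ^ l) := by
        rw [← two_mul, ← pow_succ', ← pow_add]
        congr 1; omega
      refine ⟨?_, ?_⟩
      · simp only [Test.holds, NExp.eval, h7, f6]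
        exact Nat.pow_lt_pow_right (by norm_num) hl
      · rw [hlL] at f6 hS
        rw [← f3] at hS
        have := runs_mergePass f6 h7 (by positivity) hS
        rw [← hlL, f3] at this
        refine this.mono le_rfl ?_
        rintro s'' - ⟨k1, k2⟩
        rw [pow_succ, mul_two]
        exact ⟨k1, k2⟩)
    (by
      rintro s' hf ⟨h7, -⟩
      have f6 : s'.nat 6 0 = 2 ^ L := by rw [hf.nat 6 (by decide), g6]
      simp only [Test.holds, NExp.eval, h7, f6]
      omega)
  refine hloop.mono ?_ (fun s' _ h => h.2)
  simp only [Test.cost, NExp.cost]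
  have : L * (1 + 1 + (1 + 1) + 1 + (500 * 2 ^ L + 100)) ≤ L * (500 * 2 ^ L + 120) :=
    Nat.mul_le_mul_left _ (by omega)
  omega

end RealRAM

/-! ### Ranks in a sorted list -/

/-- The number of positions `q < p` at which the key jumps: the rank of the key at position `p` of a
sorted list among the distinct keys. -/
noncomputable def rankAt (key : ℕ → ℝ) (A : ℕ → ℕ) : ℕ → ℕ
  | 0 => 0
  | p + 1 => rankAt key A p + if key (A p) < key (A (p + 1)) then 1 else 0

theorem rankAt_mono (key : ℕ → ℝ) (A : ℕ → ℕ) : Monotone (rankAt key A) :=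
  monotone_nat_of_le_succ fun _ => Nat.le_add_right _ _

/-- In a sorted list, entries with equal keys have no jump between them. In particular the rank is a
function of the key, so that writing the rank of an index twice does no harm. -/
theorem rankAt_eq_iff {key : ℕ → ℝ} {A : ℕ → ℕ} {N : ℕ} (h : SortedOn key A 0 N) {p q : ℕ}
    (hpq : p ≤ q) (hq : q < N) :
    rankAt key A p = rankAt key A q ↔ key (A p) = key (A q) := by
  induction q, hpq using Nat.le_induction with
  | base => simp
  | succ q hpq ih =>
    have ih := ih (by omega)
    have h1 := h q (q + 1) (Nat.zero_le _) (Nat.le_succ q) hq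
    have h2 := h p q (Nat.zero_le _) hpq (by omega)
    have h3 := rankAt_mono key A hpq
    rw [rankAt]
    split_ifs with hlt
    · exact iff_of_false (by omega) (by linarith)
    · rw [add_zero, ih, le_antisymm h1 (not_lt.mp hlt)]

/-- The ranks increase by at most one from each position to the next, so none is skipped. -/
theorem exists_rankAt_eq (key : ℕ → ℝ) (A : ℕ → ℕ) (q k : ℕ) (hk : k ≤ rankAt key A q) :
    ∃ p ≤ q, rankAt key A p = k := by
  induction q with
  | zero => exact ⟨0, le_rfl, (Nat.le_zero.mp hk).symm⟩
  | succ q ih =>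
    by_cases h : k ≤ rankAt key A q
    · obtain ⟨p, hp, hpk⟩ := ih h
      exact ⟨p, by omega, hpk⟩
    · refine ⟨q + 1, le_rfl, ?_⟩
      rw [rankAt] at hk ⊢
      split_ifs at hk ⊢ <;> omega

/-- The distinct keys of a sorted list in increasing order, numbered by their ranks. -/
theorem exists_enumeration_of_rankAt {key : ℕ → ℝ} {A : ℕ → ℕ} {N : ℕ} (hN : 0 < N)
    (h : SortedOn key A 0 N) :
    ∃ z : Fin (rankAt key A (N - 1) + 1) → ℝ, StrictMono z ∧
      (∀ p < N, ∀ k : Fin (rankAt key A (N - 1) + 1), (k : ℕ) = rankAt key A p → z k = key (A p)) ∧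
      ∀ k : Fin (rankAt key A (N - 1) + 1), ∃ p < N, rankAt key A p = k := by
  have hex : ∀ k : Fin (rankAt key A (N - 1) + 1), ∃ p < N, rankAt key A p = k := fun k => by
    obtain ⟨p, hp, hpk⟩ := exists_rankAt_eq key A (N - 1) k (Nat.lt_succ_iff.mp k.2)
    exact ⟨p, by omega, hpk⟩
  choose f hf hfk using hex
  refine ⟨fun k => key (A (f k)), fun k k' hkk => ?_, fun p hp k hk => ?_,
    fun k => ⟨f k, hf k, hfk k⟩⟩
  · have hlt : rankAt key A (f k) < rankAt key A (f k') := by rw [hfk, hfk]; exact hkk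
    have hle : f k ≤ f k' := by
      by_contra hgt
      exact absurd (rankAt_mono key A (not_le.mp hgt).le) (not_le.mpr hlt)
    exact lt_of_le_of_ne (h _ _ (Nat.zero_le _) hle (hf k'))
      fun heq => hlt.ne ((rankAt_eq_iff h hle (hf k')).mpr heq)
  · have heq : rankAt key A (f k) = rankAt key A p := by rw [hfk, hk]
    rcases le_total (f k) p with hle | hle
    · exact (rankAt_eq_iff h hle hp).mp heq
    · exact ((rankAt_eq_iff h hle (hf k)).mp heq.symm).symm

namespace RealRAM

/-- Walk through the sorted list and write to the array `1` the rank of each index; the array `12`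
holds the current rank. At the first position the key is compared with itself. -/
def rankProg : Prog :=
  .seq (assignN 12 (.lit 0))
    (forLoop (.lit 0) (nvar 6)
      (.seq
        (.cond (.ltR (.get 3 (.get 4 (.monus (nvar 11) (.lit 1)))) (.get 3 (.get 4 (nvar 11))))
          (assignN 12 (.plus (nvar 12) (.lit 1))) (assignN 12 (nvar 12)))
        (.setN 1 (.get 4 (nvar 11)) (nvar 12))))

theorem runs_rankProg {s : State} {N : ℕ} (hN : s.nat 6 0 = N)
    (h : SortedOn (s.real 3) (s.nat 4) 0 N) :
    Runs rankProg s ((N + 1) * 80 + 10) (fun s' =>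
      s'.nat 12 0 = rankAt (s.real 3) (s.nat 4) (N - 1) ∧
      ∀ p < N, s'.nat 1 (s.nat 4 p) = rankAt (s.real 3) (s.nat 4) p) := by
  have hset : Runs (assignN 12 (.lit 0)) s 3 (fun s' => s'.nat 12 0 = 0) :=
    Runs.of_loopFree rfl (by decide) (by simp [Prog.run, NExp.eval])
  refine (hset.seq (K' := (N + 1) * 80 + 7) (fun s0 hf0 hs0 => ?_)).mono (by omega)
    (fun _ _ h => h)
  have g6 : s0.nat 6 0 = N := by rw [hf0.nat 6 (by decide), hN]
  have g4 : s0.nat 4 = s.nat 4 := hf0.nat 4 (by decide)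
  have g3 : s0.real 3 = s.real 3 := hf0.real 3 (by decide)
  refine (Runs.forLoop (N := N)
    (fun k s' => s'.nat 12 0 = rankAt (s.real 3) (s.nat 4) (k - 1) ∧
      ∀ p < k, s'.nat 1 (s.nat 4 p) = rankAt (s.real 3) (s.nat 4) p) rfl (by decide)
    (Nat.zero_le _) ?_ ?_ ?_).mono ?_ (fun _ _ h => h)
  · simp [NExp.eval, hs0, rankAt]
  · intro k s' hf _
    simp only [NExp.eval]
    rw [hf.nat 6 (by decide), g6]
  · rintro k s' hk hf h11 ⟨h12, hI⟩
    have f4 : s'.nat 4 = s.nat 4 := by rw [hf.nat 4 (by decide), g4]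
    have f3 : s'.real 3 = s.real 3 := by rw [hf.real 3 (by decide), g3]
    have hrank : rankAt (s.real 3) (s.nat 4) k = rankAt (s.real 3) (s.nat 4) (k - 1) +
        if s.real 3 (s.nat 4 (k - 1)) < s.real 3 (s.nat 4 k) then 1 else 0 := by
      cases k with
      | zero => simp
      | succ k => rfl
    have hwrite : ∀ p < k + 1,
        (if s.nat 4 p = s.nat 4 k then rankAt (s.real 3) (s.nat 4) k
          else s'.nat 1 (s.nat 4 p)) = rankAt (s.real 3) (s.nat 4) p := by
      intro p hp
      split_ifs with hpk
      · exact ((rankAt_eq_iff h (by omega) hk).mpr (by rw [hpk])).symm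
      · refine hI p (lt_of_le_of_ne (by omega) ?_)
        rintro rfl
        exact hpk rfl
    simp only [Prog.run, Test.holds, RExp.eval, NExp.eval, f3, f4, h11, h12]
    by_cases hlt : s.real 3 (s.nat 4 (k - 1)) < s.real 3 (s.nat 4 k)
    · rw [if_pos hlt] at hrank
      simp only [if_pos hlt, State.writeNat_nat, f4, h11]
      refine ⟨by simp [hrank], fun p hp => ?_⟩
      rw [← hwrite p hp]
      simp [hrank]
    · rw [if_neg hlt, add_zero] at hrank
      simp only [if_neg hlt, State.writeNat_nat, f4, h11]
      refine ⟨by simp [hrank], fun p hp => ?_⟩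
      rw [← hwrite p hp]
      simp [hrank]
  · exact Nat.add_le_add (Nat.mul_le_mul_left _ (by decide)) (by decide)

/-! ### Computing the sweep -/

/-- The hyperbolic cosine of the value of an expression. -/
def coshE (x : RExp) : RExp :=
  .divide (.plus (.fn .exp x) (.fn .exp (.minus (.lit 0) x))) (.lit 2)

/-- The hyperbolic sine of the value of an expression. -/
def sinhE (x : RExp) : RExp :=
  .divide (.minus (.fn .exp x) (.fn .exp (.minus (.lit 0) x))) (.lit 2)

theorem eval_coshE (s : State) (x : RExp) : (coshE x).eval s = Real.cosh (x.eval s) := by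
  simp [coshE, RExp.eval, Fn.eval, Real.cosh_eq]

theorem eval_sinhE (s : State) (x : RExp) : (sinhE x).eval s = Real.sinh (x.eval s) := by
  simp [sinhE, RExp.eval, Fn.eval, Real.sinh_eq]

/-- The distance by which the pole is moved: larger by `r` than the distance of each center from the
old pole. -/
def sumProg : Prog :=
  .seq (assignR 4 (.plus (rvar 0) (rvar 0)))
    (forLoop (.lit 0) (nvar 0) (assignR 4 (.plus (rvar 4) (.get 1 (nvar 11)))))

theorem runs_sumProg {s : State} {n : ℕ} (hn : s.nat 0 0 = n) :
    Runs sumProg s ((n + 1) * 40 + 10) (fun s' =>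
      s'.real 4 0 = s.real 0 0 + s.real 0 0 + ∑ v ∈ Finset.range n, s.real 1 v) := by
  have hset : Runs (assignR 4 (.plus (rvar 0) (rvar 0))) s 10
      (fun s' => s'.real 4 0 = s.real 0 0 + s.real 0 0) :=
    Runs.of_loopFree rfl (by decide) (by simp [Prog.run, RExp.eval, NExp.eval])
  refine (hset.seq (K' := (n + 1) * 40) (fun s0 hf0 hs0 => ?_)).mono (by omega)
    (fun _ _ h => h)
  have g0 : s0.nat 0 0 = n := by rw [hf0.nat 0 (by decide), hn]
  have g1 : s0.real 1 = s.real 1 := hf0.real 1 (by decide)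
  refine (Runs.forLoop (N := n)
    (fun k s' => s'.real 4 0 = s.real 0 0 + s.real 0 0 + ∑ v ∈ Finset.range k, s.real 1 v)
    rfl (by decide) (Nat.zero_le _) ?_ ?_ ?_).mono ?_ (fun _ _ h => h)
  · simp [NExp.eval, hs0]
  · intro k s' hf _
    simp only [NExp.eval]
    rw [hf.nat 0 (by decide), g0]
  · intro k s' hk hf h11 hI
    have f1 : s'.real 1 = s.real 1 := by rw [hf.real 1 (by decide), g1]
    simp only [Prog.run, RExp.eval, NExp.eval, h11, f1, State.writeReal_real,
      State.writeNat_real, hI, Finset.sum_range_succ]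
    simp [add_assoc]
  · simp only [NExp.cost, Prog.maxCost, RExp.cost]
    omega

/-- The hyperbolic cosine of the distance from the moved pole. -/
noncomputable def boostTime (D b θ : ℝ) : ℝ :=
  Real.cosh D * Real.cosh b - Real.sinh D * (Real.sinh b * Real.cos θ)

/-- The component in the direction of the polar axis of the boosted hyperboloid coordinates. -/
noncomputable def boostRe (D b θ : ℝ) : ℝ :=
  Real.cosh D * (Real.sinh b * Real.cos θ) - Real.sinh D * Real.cosh b

/-- The radial coordinate with respect to the moved pole. -/
noncomputable def boostRadius (D b θ : ℝ) : ℝ :=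
  Real.log (boostTime D b θ + Real.sqrt (boostTime D b θ * boostTime D b θ - 1))

/-- The polar angle with respect to the moved pole. -/
noncomputable def boostAngle (D b θ : ℝ) : ℝ :=
  if Real.sinh b * Real.sin θ < 0 then
    Real.arccos (-1) + Real.arccos (-1) -
      Real.arccos (boostRe D b θ / Real.sqrt (boostTime D b θ * boostTime D b θ - 1))
  else Real.arccos (boostRe D b θ / Real.sqrt (boostTime D b θ * boostTime D b θ - 1))

/-- The polar coordinates of the `k`-th center with respect to the moved pole, the least and the
greatest polar angle of its disk, and its layer. -/
def coordBody : Prog :=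
  let D := rvar 4
  let b : RExp := .get 1 (nvar 11)
  let θ : RExp := .get 2 (nvar 11)
  let x := rvar 5
  let root : RExp := .fn .sqrt (.minus (.times x x) (.lit 1))
  .seq (assignR 5 (.minus (.times (coshE D) (coshE b))
      (.times (sinhE D) (.times (sinhE b) (.fn .cos θ)))))
    (.seq (assignR 6 (.minus (.times (coshE D) (.times (sinhE b) (.fn .cos θ)))
        (.times (sinhE D) (coshE b))))
      (.seq (assignR 7 (.fn .log (.plus x root)))
        (.seq (assignR 8 (.fn .arccos (.divide (rvar 6) root)))
          (.seq (.cond (.ltR (.times (sinhE b) (.fn .sin θ)) (.lit 0))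
              (assignR 8 (.minus (.plus (.fn .arccos (.lit (-1))) (.fn .arccos (.lit (-1))))
                (rvar 8)))
              (assignR 8 (rvar 8)))
            (.seq (.setR 3 (nvar 11) (.angInf (rvar 7) (rvar 8) (rvar 0)))
              (.seq (.setR 3 (.plus (nvar 0) (nvar 11)) (.angSup (rvar 7) (rvar 8) (rvar 0)))
                (.setCeil 3 (nvar 11) (.divide (rvar 7) (.plus (rvar 0) (rvar 0))))))))))

theorem run_coordBody (s : State) {k n : ℕ} (h11 : s.nat 11 0 = k) (h0 : s.nat 0 0 = n) :
    (∀ i, (coordBody.run s).real 3 i =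
      if i = n + k then sSup (discAngles (boostRadius (s.real 4 0) (s.real 1 k) (s.real 2 k))
        (boostAngle (s.real 4 0) (s.real 1 k) (s.real 2 k)) (s.real 0 0))
      else if i = k then sInf (discAngles (boostRadius (s.real 4 0) (s.real 1 k) (s.real 2 k))
        (boostAngle (s.real 4 0) (s.real 1 k) (s.real 2 k)) (s.real 0 0))
      else s.real 3 i) ∧
    ∀ i, (coordBody.run s).nat 3 i =
      if i = k then ⌈boostRadius (s.real 4 0) (s.real 1 k) (s.real 2 k) /
        (s.real 0 0 + s.real 0 0)⌉₊ else s.nat 3 i := by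
  simp only [coordBody, Prog.run, Test.holds, RExp.eval, NExp.eval, eval_coshE, eval_sinhE,
    Fn.eval, h11, State.writeReal_real, State.writeReal_nat]
  by_cases hneg : Real.sinh (s.real 1 k) * Real.sin (s.real 2 k) < 0
  · simp [hneg, h0, h11, boostRadius, boostAngle, boostRe, boostTime]
  · simp [hneg, h0, h11, boostRadius, boostAngle, boostRe, boostTime]

theorem runs_coordLoop {s : State} {n : ℕ} (hn : s.nat 0 0 = n) :
    Runs (forLoop (.lit 0) (nvar 0) coordBody) s ((n + 1) * 300 + 10) (fun s' => ∀ v < n,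
      s'.real 3 v = sInf (discAngles (boostRadius (s.real 4 0) (s.real 1 v) (s.real 2 v))
        (boostAngle (s.real 4 0) (s.real 1 v) (s.real 2 v)) (s.real 0 0)) ∧
      s'.real 3 (n + v) = sSup (discAngles (boostRadius (s.real 4 0) (s.real 1 v) (s.real 2 v))
        (boostAngle (s.real 4 0) (s.real 1 v) (s.real 2 v)) (s.real 0 0)) ∧
      s'.nat 3 v = ⌈boostRadius (s.real 4 0) (s.real 1 v) (s.real 2 v) /
        (s.real 0 0 + s.real 0 0)⌉₊) := by
  refine (Runs.forLoop (N := n)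
    (fun k s' => ∀ v < k,
      s'.real 3 v = sInf (discAngles (boostRadius (s.real 4 0) (s.real 1 v) (s.real 2 v))
        (boostAngle (s.real 4 0) (s.real 1 v) (s.real 2 v)) (s.real 0 0)) ∧
      s'.real 3 (n + v) = sSup (discAngles (boostRadius (s.real 4 0) (s.real 1 v) (s.real 2 v))
        (boostAngle (s.real 4 0) (s.real 1 v) (s.real 2 v)) (s.real 0 0)) ∧
      s'.nat 3 v = ⌈boostRadius (s.real 4 0) (s.real 1 v) (s.real 2 v) /
        (s.real 0 0 + s.real 0 0)⌉₊)
    rfl (by decide) (Nat.zero_le _) ?_ ?_ ?_).mono ?_ (fun _ _ h => h)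
  · intro v hv
    simp [NExp.eval] at hv
  · intro k s' hf _
    simp only [NExp.eval]
    rw [hf.nat 0 (by decide), hn]
  · intro k s' hk hf h11 hI v hv
    have f0 : s'.nat 0 0 = n := by rw [hf.nat 0 (by decide), hn]
    have r0 : s'.real 0 = s.real 0 := hf.real 0 (by decide)
    have r1 : s'.real 1 = s.real 1 := hf.real 1 (by decide)
    have r2 : s'.real 2 = s.real 2 := hf.real 2 (by decide)
    have r4 : s'.real 4 = s.real 4 := hf.real 4 (by decide)
    obtain ⟨k1, k2⟩ := run_coordBody s' h11 f0
    rw [r0, r1, r2, r4] at k1 k2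
    simp only [State.writeNat_real, State.writeNat_nat, k1, k2]
    rcases Nat.lt_succ_iff_lt_or_eq.mp hv with hv | rfl
    · obtain ⟨i1, i2, i3⟩ := hI v hv
      rw [if_neg (by omega), if_neg (by omega), if_neg (by omega), if_neg (by omega),
        if_neg (by omega), if_neg (by omega)]
      exact ⟨i1, i2, i3⟩
    · rw [if_neg (by omega), if_pos rfl, if_pos rfl, if_neg (by omega), if_pos rfl]
      exact ⟨rfl, rfl, rfl⟩
  · have : coordBody.maxCost ≤ 280 := by decide
    simp only [NExp.cost]
    nlinarith

/-- Pad the list of the `2 n` keys with copies of the first one, to a power of two, and initialize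
the list of indices. -/
def padProg : Prog :=
  .seq (.seq (assignN 6 (.lit 1))
      (.loop (.ltN (nvar 6) (.plus (nvar 0) (nvar 0))) (assignN 6 (.plus (nvar 6) (nvar 6)))))
    (.seq (forLoop (.plus (nvar 0) (nvar 0)) (nvar 6) (.setR 3 (nvar 11) (.get 3 (.lit 0))))
      (forLoop (.lit 0) (nvar 6) (.setN 4 (nvar 11) (nvar 11))))

theorem runs_padProg {s : State} {n L : ℕ} (hn : s.nat 0 0 = n) (hn1 : 1 ≤ n)
    (hL : n + n ≤ 2 ^ L) (hL' : ∀ l < L, 2 ^ l < n + n) :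
    Runs padProg s (L * 30 + (2 ^ L + 1) * 80 + 50) (fun s' => s'.nat 6 0 = 2 ^ L ∧
      (∀ x < n + n, s'.real 3 x = s.real 3 x) ∧
      (∀ x, n + n ≤ x → x < 2 ^ L → s'.real 3 x = s.real 3 0) ∧
      ∀ p < 2 ^ L, s'.nat 4 p = p) := by
  have hset : Runs (assignN 6 (.lit 1)) s 3 (fun s' => s'.nat 6 0 = 1) :=
    Runs.of_loopFree rfl (by decide) (by simp [Prog.run, NExp.eval])
  have hdouble : Runs (.seq (assignN 6 (.lit 1))
      (.loop (.ltN (nvar 6) (.plus (nvar 0) (nvar 0))) (assignN 6 (.plus (nvar 6) (nvar 6))))) s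
      (L * 30 + 20) (fun s' => s'.nat 6 0 = 2 ^ L) := by
    refine (hset.seq (K' := L * 30 + 15) (fun s0 hf0 hs0 => ?_)).mono (by omega)
      (fun _ _ h => h)
    have g0 : s0.nat 0 0 = n := by rw [hf0.nat 0 (by decide), hn]
    refine (Runs.loop (K := 10) L (fun l s' => s'.nat 6 0 = 2 ^ l) hs0 ?_ ?_).mono ?_
      (fun _ _ h => h)
    · intro l s' hl hf hI
      have f0 : s'.nat 0 0 = n := by rw [hf.nat 0 (by decide), g0]
      refine ⟨by simpa only [Test.holds, NExp.eval, hI, f0] using hL' l hl, ?_⟩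
      apply Runs.of_loopFree rfl (by decide)
      simp [Prog.run, NExp.eval, hI, pow_succ, mul_two]
    · intro s' hf hI
      have f0 : s'.nat 0 0 = n := by rw [hf.nat 0 (by decide), g0]
      simp only [Test.holds, NExp.eval, hI, f0]
      omega
    · simp only [Test.cost, NExp.cost]; omega
  refine (hdouble.seq (K' := (2 ^ L + 1) * 80 + 20) (fun s1 hf1 hs1 => ?_)).mono (by omega)
    (fun _ _ h => h)
  have g0 : s1.nat 0 0 = n := by rw [hf1.nat 0 (by decide), hn]
  have g3 : s1.real 3 = s.real 3 := hf1.real 3 (by decide)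
  have hpad : Runs (forLoop (.plus (nvar 0) (nvar 0)) (nvar 6)
      (.setR 3 (nvar 11) (.get 3 (.lit 0)))) s1 ((2 ^ L + 1) * 40 + 10) (fun s' =>
      (∀ x < n + n, s'.real 3 x = s.real 3 x) ∧
      ∀ x, n + n ≤ x → x < 2 ^ L → s'.real 3 x = s.real 3 0) := by
    refine (Runs.forLoop (N := 2 ^ L) (fun k s' => n + n ≤ k ∧
      (∀ x < n + n, s'.real 3 x = s.real 3 x) ∧
      ∀ x, n + n ≤ x → x < k → s'.real 3 x = s.real 3 0)
      rfl (by decide) ?_ ?_ ?_ ?_).mono ?_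
      (fun _ _ h => h.2)
    · simpa only [NExp.eval, g0] using hL
    · simp only [NExp.eval, g0, State.writeNat_real, g3]
      exact ⟨le_rfl, fun _ _ => trivial, fun x h1 h2 => by omega⟩
    · intro k s' hf _
      simp only [NExp.eval]
      rw [hf.nat 6 (by decide), hs1]
    · rintro k s' hk hf h11 ⟨i0, i1, i2⟩
      have h30 : s'.real 3 0 = s.real 3 0 := i1 0 (by omega)
      simp only [Prog.run, NExp.eval, RExp.eval, h11, State.writeNat_real, State.writeReal_real,
        h30]
      refine ⟨by omega, fun x hx => ?_, fun x hx hx' => ?_⟩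
      · split_ifs with h
        · omega
        · exact i1 x hx
      · split_ifs with h
        · rfl
        · exact i2 x hx (lt_of_le_of_ne (Nat.lt_succ_iff.mp hx') fun h' => h (by simp [h']))
    · simp only [NExp.cost, RExp.cost, Prog.maxCost]; omega
  refine (hpad.seq (K' := (2 ^ L + 1) * 40 + 10) (fun s2 hf2 hs2 => ?_)).mono (by omega)
    (fun _ _ h => h)
  have k6 : s2.nat 6 0 = 2 ^ L := by rw [hf2.nat 6 (by decide), hs1]
  refine (Runs.forLoop (N := 2 ^ L) (fun k s' => ∀ p < k, s'.nat 4 p = p) rfl (by decide)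
    (Nat.zero_le _) (fun p hp => by simp [NExp.eval] at hp) ?_ ?_).mono ?_ ?_
  · intro k s' hf _
    simp only [NExp.eval]
    rw [hf.nat 6 (by decide), k6]
  · intro k s' hk hf h11 hI p hp
    simp only [Prog.run, NExp.eval, h11, State.writeNat_nat]
    rcases Nat.lt_succ_iff_lt_or_eq.mp hp with hp | rfl
    · simp [hp.ne, hI p hp]
    · simp
  · simp only [NExp.cost, Prog.maxCost]; omega
  · intro s' hf hI
    have f3 : s'.real 3 = s2.real 3 := hf.real 3 (by decide)
    rw [hf.nat 6 (by decide), f3]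
    exact ⟨k6, hs2.1, hs2.2, hI⟩

end RealRAM

/-! ### The complete program -/

namespace RealRAM

/-- The ranks of the least and the greatest polar angle of a disk are its first and last node. -/
def outProg : Prog :=
  .seq (forLoop (.lit 0) (nvar 0) (.setN 2 (nvar 11) (.get 1 (.plus (nvar 0) (nvar 11)))))
    (assignN 0 (.plus (nvar 12) (.lit 1)))

theorem runs_outProg {s : State} {n : ℕ} (hn : s.nat 0 0 = n) :
    Runs outProg s ((n + 1) * 40 + 20) (fun s' => s'.nat 0 0 = s.nat 12 0 + 1 ∧
      ∀ v < n, s'.nat 2 v = s.nat 1 (n + v)) := by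
  have hcopy : Runs (forLoop (.lit 0) (nvar 0)
      (.setN 2 (nvar 11) (.get 1 (.plus (nvar 0) (nvar 11))))) s ((n + 1) * 40 + 1)
      (fun s' => ∀ v < n, s'.nat 2 v = s.nat 1 (n + v)) := by
    refine (Runs.forLoop (N := n) (fun k s' => ∀ v < k, s'.nat 2 v = s.nat 1 (n + v)) rfl
      (by decide) (Nat.zero_le _) (fun p hp => by simp [NExp.eval] at hp) ?_ ?_).mono ?_
      (fun _ _ h => h)
    · intro k s' hf _
      simp only [NExp.eval]
      rw [hf.nat 0 (by decide), hn]
    · intro k s' hk hf h11 hI v hv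
      have f0 : s'.nat 0 0 = n := by rw [hf.nat 0 (by decide), hn]
      have f1 : s'.nat 1 = s.nat 1 := hf.nat 1 (by decide)
      simp only [Prog.run, NExp.eval, h11, f0, f1, State.writeNat_nat]
      rcases Nat.lt_succ_iff_lt_or_eq.mp hv with hv | rfl
      · simp [hv.ne, hI v hv]
      · simp
    · exact Nat.add_le_add (Nat.mul_le_mul_left _ (by decide)) (by decide)
  refine (hcopy.seq (K' := 19) (fun s1 hf1 h1 => ?_)).mono (by omega) (fun _ _ h => h)
  apply Runs.of_loopFree rfl (by decide)
  simp only [Prog.run, NExp.eval, hf1.nat 12 (by decide), State.writeNat_nat]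
  refine ⟨by simp, fun v hv => ?_⟩
  rw [← h1 v hv]
  simp

/-- The program that computes the angular sweep and the annular layering. -/
def sweepProg : Prog :=
  .seq sumProg (.seq (forLoop (.lit 0) (nvar 0) coordBody)
    (.seq padProg (.seq mergeSort (.seq rankProg outProg))))

/-- A bound on the number of steps of `sweepProg`, with a generous constant. -/
def sweepTime (n : ℕ) : ℕ := 10000 * ((n + 1) * (Nat.log 2 n + 3))

theorem sweepTime_isBigO :
    (fun n : ℕ => (sweepTime n : ℝ)) =O[Filter.atTop] fun n : ℕ => (n : ℝ) * Real.log n := by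
  refine IsBigO.of_bound (10000 * (8 / Real.log 2)) ?_
  filter_upwards [Filter.eventually_ge_atTop 2] with n hn
  have h2 : (0 : ℝ) < Real.log 2 := Real.log_pos (by norm_num)
  have hn' : (2 : ℝ) ≤ n := by exact_mod_cast hn
  have h1 : Real.log 2 ≤ Real.log n := Real.log_le_log (by norm_num) hn'
  have h3 : (Nat.log 2 n : ℝ) * Real.log 2 ≤ Real.log n := by
    rw [← Real.log_pow]
    apply Real.log_le_log (by positivity)
    exact_mod_cast Nat.pow_log_le_self 2 (by omega)
  have h4 : ((Nat.log 2 n : ℝ) + 3) * Real.log 2 ≤ 4 * Real.log n := by linarith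
  have h5 : ((n : ℝ) + 1) ≤ 2 * n := by linarith
  rw [Real.norm_of_nonneg (by positivity), Real.norm_of_nonneg (by nlinarith)]
  have h6 : ((n : ℝ) + 1) * (((Nat.log 2 n : ℝ) + 3) * Real.log 2) ≤
      2 * n * (4 * Real.log n) := mul_le_mul h5 h4 (by positivity) (by positivity)
  unfold sweepTime
  push_cast
  rw [← sub_nonneg]
  have h7 : 10000 * (8 / Real.log 2) * ((n : ℝ) * Real.log n) -
      10000 * (((n : ℝ) + 1) * ((Nat.log 2 n : ℝ) + 3)) =
      10000 / Real.log 2 * (2 * n * (4 * Real.log n) -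
        ((n : ℝ) + 1) * (((Nat.log 2 n : ℝ) + 3) * Real.log 2)) := by
    field_simp
    ring
  rw [h7]
  exact mul_nonneg (by positivity) (by linarith)

/-- The list of `2 n` keys is padded to length `2 ^ L`, which at most doubles it. -/
theorem exists_pow_two_between {n : ℕ} (hn : 1 ≤ n) :
    ∃ L, n + n ≤ 2 ^ L ∧ (∀ l < L, 2 ^ l < n + n) ∧ 2 ^ L ≤ 4 * n ∧ L ≤ Nat.log 2 n + 2 := by
  have hex : ∃ L, n + n ≤ 2 ^ L := ⟨n + n, Nat.lt_two_pow_self.le⟩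
  classical
  have hmin : ∀ l < Nat.find hex, 2 ^ l < n + n := fun l hl => not_le.mp (Nat.find_min hex hl)
  have h0 : Nat.find hex ≠ 0 := by
    intro h
    have := Nat.find_spec hex
    rw [h] at this
    omega
  have h1 := hmin (Nat.find hex - 1) (by omega)
  have h2 : 2 ^ Nat.find hex = 2 ^ (Nat.find hex - 1) * 2 := by
    rw [← pow_succ]; congr 1; omega
  refine ⟨Nat.find hex, Nat.find_spec hex, hmin, by omega, ?_⟩
  by_contra hlt
  have h3 : Nat.log 2 n + 1 + 1 ≤ Nat.find hex - 1 := by omega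
  have h4 := Nat.pow_le_pow_right (n := 2) (by norm_num) h3
  have h5 := Nat.lt_pow_succ_log_self (b := 2) (by norm_num) n
  rw [pow_succ] at h4
  omega

/-- What the program computes, in terms of the polar angles of the disks: `z` enumerates the extreme
polar angles, and the arrays `1` and `2` hold the ranks of the extreme polar angles of each disk. -/
theorem runs_sweepProg {s : State} {n : ℕ} (hn : s.nat 0 0 = n) (hn1 : 1 ≤ n)
    {D : ℝ} (hD : D = s.real 0 0 + s.real 0 0 + ∑ v ∈ Finset.range n, s.real 1 v) :
    Runs sweepProg s (sweepTime n) (fun s' => s'.numNodes ≠ 0 ∧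
      (∀ v < n, s'.nat 3 v = ⌈boostRadius D (s.real 1 v) (s.real 2 v) /
        (s.real 0 0 + s.real 0 0)⌉₊) ∧
      ∃ z : Fin s'.numNodes → ℝ, StrictMono z ∧
        (∀ k : Fin s'.numNodes, ∃ v < n, (k : ℕ) = s'.nat 1 v ∨ (k : ℕ) = s'.nat 2 v) ∧
        ∀ v < n, ∃ f l : Fin s'.numNodes, (f : ℕ) = s'.nat 1 v ∧ (l : ℕ) = s'.nat 2 v ∧
          z f = sInf (discAngles (boostRadius D (s.real 1 v) (s.real 2 v))
            (boostAngle D (s.real 1 v) (s.real 2 v)) (s.real 0 0)) ∧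
          z l = sSup (discAngles (boostRadius D (s.real 1 v) (s.real 2 v))
            (boostAngle D (s.real 1 v) (s.real 2 v)) (s.real 0 0))) := by
  obtain ⟨L, hL1, hL2, hL3, hL4⟩ := exists_pow_two_between hn1
  have htime : ((n + 1) * 40 + 10) + (((n + 1) * 300 + 10) + ((L * 30 + (2 ^ L + 1) * 80 + 50) +
      ((L * (500 * 2 ^ L + 120) + 20) + (((2 ^ L + 1) * 80 + 10) + ((n + 1) * 40 + 20)))))
      ≤ sweepTime n := by
    have h1 : L * 2 ^ L ≤ (Nat.log 2 n + 2) * (4 * n) := Nat.mul_le_mul hL4 hL3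
    unfold sweepTime
    generalize 2 ^ L = N at *
    generalize Nat.log 2 n = l at *
    have h2 : L * (500 * N + 120) = 500 * (L * N) + 120 * L := by ring
    have h3 : (l + 2) * (4 * n) = 4 * (n * l) + 8 * n := by ring
    have h4 : (n + 1) * (l + 3) = n * l + 3 * n + l + 3 := by ring
    rw [h2, h4]
    rw [h3] at h1
    generalize L * N = x at *
    generalize n * l = y at *
    omega
  refine Runs.mono ?_ htime (fun _ _ h => h)
  refine (runs_sumProg hn).seq fun s1 hf1 h1 => ?_
  rw [← hD] at h1
  have a0 : s1.nat 0 0 = n := by rw [hf1.nat 0 (by decide), hn]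
  have a1 : s1.real 1 = s.real 1 := hf1.real 1 (by decide)
  have a2 : s1.real 2 = s.real 2 := hf1.real 2 (by decide)
  have a3 : s1.real 0 = s.real 0 := hf1.real 0 (by decide)
  refine (runs_coordLoop a0).seq fun s2 hf2 h2 => ?_
  rw [a1, a2, a3, h1] at h2
  have b0 : s2.nat 0 0 = n := by rw [hf2.nat 0 (by decide), a0]
  refine (runs_padProg b0 hn1 hL1 hL2).seq fun s3 hf3 h3 => ?_
  obtain ⟨c6, cold, cpad, c4⟩ := h3
  refine (runs_mergeSort c6 c4).seq fun s4 hf4 h4 => ?_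
  have d6 : s4.nat 6 0 = 2 ^ L := by rw [hf4.nat 6 (by decide), c6]
  have d3 : s4.real 3 = s3.real 3 := hf4.real 3 (by decide)
  rw [← d3] at h4
  have hsort : SortedOn (s4.real 3) (s4.nat 4) 0 (2 ^ L) := by
    have := h4.sorted 0 (by simp)
    simpa using this
  refine (runs_rankProg d6 hsort).seq fun s5 hf5 h5 => ?_
  obtain ⟨e12, e1⟩ := h5
  have e0 : s5.nat 0 0 = n := by
    rw [hf5.nat 0 (by decide), hf4.nat 0 (by decide), hf3.nat 0 (by decide), b0]
  refine (runs_outProg e0).mono le_rfl fun s6 hf6 h6 => ?_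
  obtain ⟨g0, g2⟩ := h6
  have g1 : s6.nat 1 = s5.nat 1 := hf6.nat 1 (by decide)
  have g3 : s6.nat 3 = s2.nat 3 := by
    rw [hf6.nat 3 (by decide), hf5.nat 3 (by decide), hf4.nat 3 (by decide),
      hf3.nat 3 (by decide)]
  have hm : s6.numNodes = rankAt (s4.real 3) (s4.nat 4) (2 ^ L - 1) + 1 := by
    rw [State.numNodes, g0, e12]
  refine ⟨by omega, fun v hv => by rw [g3]; exact (h2 v hv).2.2, ?_⟩
  rw [hm]
  obtain ⟨z, hz, hzkey, hzex⟩ := exists_enumeration_of_rankAt (by positivity) hsort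
  have hkey : ∀ x < n + n, s4.real 3 x = s2.real 3 x := fun x hx => by rw [d3, cold x hx]
  have hkeypad : ∀ x, n + n ≤ x → x < 2 ^ L → s4.real 3 x = s4.real 3 0 := fun x hx hx' => by
    rw [d3, cpad x hx hx', cold 0 (by omega)]
  have hnode : ∀ x < 2 ^ L, ∃ k : Fin (rankAt (s4.real 3) (s4.nat 4) (2 ^ L - 1) + 1),
      (k : ℕ) = s5.nat 1 x ∧ z k = s4.real 3 x := by
    intro x hx
    obtain ⟨p, hp, rfl⟩ := h4.surj x hx
    have hle := rankAt_mono (s4.real 3) (s4.nat 4) (by omega : p ≤ 2 ^ L - 1)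
    exact ⟨⟨rankAt (s4.real 3) (s4.nat 4) p, by omega⟩, (e1 p hp).symm, hzkey p hp _ rfl⟩
  refine ⟨z, hz, fun k => ?_, fun v hv => ?_⟩
  · -- a node that comes from the padding has the same key as the index `0`
    have hsmall : ∃ x < n + n, (k : ℕ) = s5.nat 1 x := by
      obtain ⟨p, hp, hpk⟩ := hzex k
      have hzk := hzkey p hp k hpk.symm
      by_cases hx : s4.nat 4 p < n + n
      · exact ⟨_, hx, by rw [← hpk, e1 p hp]⟩
      · obtain ⟨k', hk', hzk'⟩ := hnode 0 (by omega)
        refine ⟨0, by omega, ?_⟩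
        rw [← hk', Fin.val_inj]
        apply hz.injective
        rw [hzk, hzk', hkeypad _ (by omega) (h4.lt p hp)]
    obtain ⟨x, hx, hxk⟩ := hsmall
    rw [g1]
    by_cases hxn : x < n
    · exact ⟨x, hxn, Or.inl hxk⟩
    · refine ⟨x - n, by omega, Or.inr ?_⟩
      rw [g2 _ (by omega), hxk]
      congr 1; omega
  · obtain ⟨f, hf, hzf⟩ := hnode v (by omega)
    obtain ⟨l, hl, hzl⟩ := hnode (n + v) (by omega)
    refine ⟨f, l, by rw [g1, hf], by rw [g2 v hv, hl], ?_, ?_⟩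
    · rw [hzf, hkey v (by omega)]; exact (h2 v hv).1
    · rw [hzl, hkey (n + v) (by omega)]; exact (h2 v hv).2.1

end RealRAM

/-! ### Coordinates with respect to the moved pole -/

/-- The coordinate change that the program evaluates. The arc cosine yields an angle in `[0, π]`; for
points below the axis it is reflected. -/
theorem PolarSystem.IsCoord.boost {S S' : PolarSystem} {D b θ : ℝ} {p : UpperHalfPlane}
    (hS' : ∀ p, Real.cosh (S'.radius p) =
        Real.cosh D * Real.cosh (S.radius p) - Real.sinh D * (S.spatial p).re ∧
      (S'.spatial p).re =
        Real.cosh D * (S.spatial p).re - Real.sinh D * Real.cosh (S.radius p) ∧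
      (S'.spatial p).im = (S.spatial p).im)
    (h : S.IsCoord p b θ) :
    S'.IsCoord p (RealRAM.boostRadius D b θ) (RealRAM.boostAngle D b θ) := by
  obtain ⟨h1, h2, h3⟩ := hS' p
  have hre := h.re_spatial
  have him := h.im_spatial
  have hb := h.1
  rw [hre, ← hb] at h1 h2
  rw [him] at h3
  have hX : RealRAM.boostTime D b θ = Real.cosh (S'.radius p) := h1.symm
  have hR : RealRAM.boostRe D b θ = (S'.spatial p).re := h2.symm
  have hrad0 := S'.radius_nonneg p
  refine ⟨?_, fun hp => ?_⟩
  · rw [RealRAM.boostRadius, hX, ← sq]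
    exact Real.arcosh_cosh hrad0
  · have hpos : 0 < S'.radius p := dist_pos.mpr hp
    have hsinh : 0 < Real.sinh (S'.radius p) := Real.sinh_pos_iff.mpr hpos
    have hroot : Real.sqrt (Real.cosh (S'.radius p) * Real.cosh (S'.radius p) - 1) =
        Real.sinh (S'.radius p) := by
      rw [← sq, Real.cosh_sq, add_sub_cancel_right, Real.sqrt_sq hsinh.le]
    have hc := S'.isCoord_radius_angle p
    have hq : (S'.spatial p).re / Real.sinh (S'.radius p) = Real.cos (S'.angle p) := by
      rw [hc.re_spatial]; field_simp
    have hang : S'.angle p ∈ Set.Ico 0 (2 * Real.pi) := by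
      rw [PolarSystem.angle_eq_argIco]; exact argIco_mem _
    have hsin := hc.im_spatial
    rw [RealRAM.boostAngle, hX, hR, hroot, hq, ← h3, hsin]
    split_ifs with hneg
    · have hs : Real.sin (S'.angle p) < 0 := by
        by_contra h0
        exact absurd hneg (not_lt.mpr (mul_nonneg hsinh.le (not_lt.mp h0)))
      have hpi : Real.pi ≤ S'.angle p := by
        by_contra h0
        exact absurd hs (not_lt.mpr (Real.sin_nonneg_of_nonneg_of_le_pi hang.1 (not_le.mp h0).le))
      rw [Real.arccos_neg_one, ← Real.cos_two_pi_sub, Real.arccos_cos]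
      · ring
      · linarith [hang.2]
      · linarith
    · have hpi : S'.angle p ≤ Real.pi := by
        by_contra h0
        apply hneg
        apply mul_neg_of_pos_of_neg hsinh
        rw [← Real.sin_sub_two_pi]
        apply Real.sin_neg_of_neg_of_neg_pi_lt
        · linarith [hang.2]
        · linarith [not_le.mp h0]
      rw [Real.arccos_cos hang.1 hpi]

/-- The axis that starts on the old axis at distance `D` from the old pole, and points away from
it, stays at distance at least `D` from the old pole. -/
theorem disjoint_ray_of_boost {S S' : PolarSystem} {D r : ℝ} (hD : 0 ≤ D)
    (hS' : ∀ p, Real.cosh (S'.radius p) =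
        Real.cosh D * Real.cosh (S.radius p) - Real.sinh D * (S.spatial p).re ∧
      (S'.spatial p).re =
        Real.cosh D * (S.spatial p).re - Real.sinh D * Real.cosh (S.radius p) ∧
      (S'.spatial p).im = (S.spatial p).im)
    {c : UpperHalfPlane} (hc : S.radius c + r < D) :
    Disjoint (Metric.closedBall c r) (S'.ray 0) := by
  rw [Set.disjoint_left]
  intro p hp hray
  have hray' : S'.angle p = 0 := hray
  rw [PolarSystem.angle_eq_argIco, argIco_eq_zero_iff] at hray'
  obtain ⟨h1, h2, -⟩ := hS' p
  have h3 : Real.cosh (S.radius p) =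
      Real.cosh D * Real.cosh (S'.radius p) + Real.sinh D * (S'.spatial p).re := by
    rw [h1, h2]
    linear_combination -Real.cosh (S.radius p) * Real.cosh_sq D
  have h4 : Real.cosh D ≤ Real.cosh (S.radius p) := by
    rw [h3]
    have := mul_nonneg (Real.sinh_nonneg_iff.mpr hD) hray'.1
    have := Real.one_le_cosh (S'.radius p)
    have := Real.cosh_pos D
    nlinarith
  rw [Real.cosh_le_cosh, abs_of_nonneg hD, abs_of_nonneg (S.radius_nonneg p)] at h4
  have h5 : S.radius p ≤ dist p c + S.radius c := dist_triangle _ _ _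
  rw [Metric.mem_closedBall] at hp
  linarith

/-- The pole is moved by `D = 2 r + ∑ b v`, which exceeds `b v + r` for every `v`. -/
theorem sweepProg_correct {r : ℝ} (hr : 0 < r) {n : ℕ} (hn : 1 ≤ n)
    {G : SimpleGraph (Fin n)} {c : Fin n → UpperHalfPlane} (hG : IsDiskRealization G r c)
    {S : PolarSystem} {b θ : Fin n → ℝ} (hb : ∀ v, S.IsCoord (c v) (b v) (θ v)) :
    RealRAM.Runs RealRAM.sweepProg (RealRAM.input n r b θ) (RealRAM.sweepTime n) (fun out =>
      IsTreeDecomposition G (SimpleGraph.pathGraph out.numNodes) (out.bag n) ∧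
      out.numNodes ≤ 2 * n ∧
      IsLayering G (out.layer n) ∧
      WitnessLayered G (out.bag n) (out.layer n) (6 * ⌈r / Real.tanh r⌉₊) ∧
      ∃ S' : PolarSystem,
        IsAngularSweep S' r c (out.bag n) ∧ IsAnnularLayering S' r c (out.layer n)) := by
  set s := RealRAM.input n r b θ with hs
  have hr0 : s.real 0 0 = r := by simp [hs, RealRAM.input]
  have hr1 : ∀ v : Fin n, s.real 1 v = b v := fun v => by simp [hs, RealRAM.input]
  have hr2 : ∀ v : Fin n, s.real 2 v = θ v := fun v => by simp [hs, RealRAM.input]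
  set D := s.real 0 0 + s.real 0 0 + ∑ v ∈ Finset.range n, s.real 1 v with hD
  refine (RealRAM.runs_sweepProg (by simp [hs, RealRAM.input]) hn hD).mono le_rfl ?_
  rintro out - ⟨hm, hlay, z, hz, hrange, hends⟩
  obtain ⟨S', hS'⟩ := S.exists_boost D
  have hb0 : ∀ v, 0 ≤ b v := fun v => by rw [(hb v).1]; exact S.radius_nonneg _
  have hDb : ∀ v, b v + r < D := by
    intro v
    have hsum : ∑ v ∈ Finset.range n, s.real 1 v = ∑ v : Fin n, b v := by
      rw [Finset.sum_range]
      exact Finset.sum_congr rfl fun v _ => hr1 v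
    have := Finset.single_le_sum (f := b) (fun v _ => hb0 v) (Finset.mem_univ v)
    rw [hD, hsum, hr0]
    linarith
  have hD0 : 0 ≤ D := by
    have := hDb ⟨0, hn⟩
    have := hb0 ⟨0, hn⟩
    linarith
  have hdis : ∀ v, Disjoint (Metric.closedBall (c v) r) (S'.ray 0) := fun v =>
    disjoint_ray_of_boost hD0 hS' (by rw [← (hb v).1]; exact hDb v)
  have hcoord := fun v => (hb v).boost hS'
  have hlay' : ∀ v : Fin n, out.nat 3 v = ⌈S'.radius (c v) / (2 * r)⌉₊ := by
    intro v
    rw [hlay v v.2, hr1, hr2, hr0, ← (hcoord v).1, two_mul]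
  have hends' : ∀ v : Fin n, ∃ f l : Fin out.numNodes, (f : ℕ) = out.nat 1 v ∧
      (l : ℕ) = out.nat 2 v ∧ z f = S'.angleInf (c v) r ∧ z l = S'.angleSup (c v) r := by
    intro v
    obtain ⟨f, l, hf, hl, hzf, hzl⟩ := hends v v.2
    rw [hr1, hr2, hr0, ← PolarSystem.image_angle_closedBall (hcoord v)] at hzf hzl
    exact ⟨f, l, hf, hl, hzf, hzl⟩
  choose first last hfirst hlast hzf hzl using hends'
  have hbag : out.bag n = fun k => {v | first v ≤ k ∧ k ≤ last v} := by
    funext k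
    ext v
    change out.nat 1 v ≤ k ∧ (k : ℕ) ≤ out.nat 2 v ↔ first v ≤ k ∧ k ≤ last v
    rw [← hfirst, ← hlast]
    rfl
  have hrange' : ∀ k, ∃ v, k = first v ∨ k = last v := by
    intro k
    obtain ⟨v, hv, hk⟩ := hrange k
    refine ⟨⟨v, hv⟩, ?_⟩
    rw [Fin.ext_iff, Fin.ext_iff, hfirst, hlast]
    exact hk
  have hann : IsAnnularLayering S' r c (out.layer n) :=
    isAnnularLayering_ceil hr hlay' fun v => hr.trans (lt_radius_of_disjoint_ray hdis v)
  have hsweep : IsAngularSweep S' r c (out.bag n) := by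
    rw [hbag]
    exact isAngularSweep_of_rank hr hdis hz hrange' hzf hzl
  refine ⟨?_, ?_, isLayering_of_isAnnularLayering hr hG hann,
    witnessLayered_of_sweep hr hG hsweep hann, S', hsweep, hann⟩
  · rw [hbag]
    exact isTreeDecomposition_of_rank hr hG hdis hz (Nat.pos_of_ne_zero hm) hzf hzl
  · have hsurj : Function.Surjective (Sum.elim first last) := by
      intro k
      obtain ⟨v, hv | hv⟩ := hrange' k
      · exact ⟨Sum.inl v, hv.symm⟩
      · exact ⟨Sum.inr v, hv.symm⟩
    have := Fintype.card_le_of_surjective _ hsurj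
    simp only [Fintype.card_fin, Fintype.card_sum] at this
    omega

theorem mainTheorem3 :
    (∃ (P : RealRAM.Prog) (T : ℕ → ℕ),
      (fun n : ℕ => (T n : ℝ)) =O[Filter.atTop] (fun n : ℕ => (n : ℝ) * Real.log (n : ℝ)) ∧
      ∀ (r : ℝ), 0 < r → ∀ (n : ℕ), 1 ≤ n →
      ∀ (G : SimpleGraph (Fin n)) (c : Fin n → UpperHalfPlane), IsDiskRealization G r c →
      ∀ (S : PolarSystem) (b θ : Fin n → ℝ), (∀ v, S.IsCoord (c v) (b v) (θ v)) →
      ∃ (t : ℕ) (out : RealRAM.State),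
        RealRAM.Exec P (RealRAM.input n r b θ) t out ∧ t ≤ T n ∧
        IsTreeDecomposition G (SimpleGraph.pathGraph out.numNodes) (out.bag n) ∧
        out.numNodes ≤ 2 * n ∧
        IsLayering G (out.layer n) ∧
        WitnessLayered G (out.bag n) (out.layer n) (6 * ⌈r / Real.tanh r⌉₊) ∧
        ∃ S' : PolarSystem,
          IsAngularSweep S' r c (out.bag n) ∧ IsAnnularLayering S' r c (out.layer n)) ∧
    (∀ {V : Type*} [Finite V] (G : SimpleGraph V) (r : ℝ), 0 < r →
      IsHyperbolicUniformDiskGraph G r →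
      layeredTreeIndepNum G ≤ ((6 * ⌈r / Real.tanh r⌉₊ : ℕ) : ℕ∞)) := by
  refine ⟨⟨RealRAM.sweepProg, RealRAM.sweepTime, RealRAM.sweepTime_isBigO,
    fun r hr n hn G c hG S b θ hb => sweepProg_correct hr hn hG hb⟩, ?_⟩
  intro V _ G r hr ⟨c, hc⟩
  rcases isEmpty_or_nonempty V with hV | hV
  · exact layeredTreeIndepNum_of_isEmpty G _
  · obtain ⟨n, ⟨e⟩⟩ := Finite.exists_equiv_fin V
    have hn : 1 ≤ n := Fin.pos (e hV.some)
    have hG : IsDiskRealization (G.comap e.symm) r (c ∘ e.symm) := fun u v => by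
      rw [SimpleGraph.comap_adj, hc]
      simp
    obtain ⟨t, out, -, -, hT, -, hL, hw, -⟩ := sweepProg_correct hr hn hG
      (fun v => PolarSystem.standard.isCoord_radius_angle ((c ∘ e.symm) v))
    exact layeredTreeIndepNum_le e (fun u v => by simp) hT hL hw
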